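/- All graphs are finite and simple. A hole is a chordless cycle with at least four vertices. For $i\ge 2$, let $H_i$ be the graph obtained from a chordless path $u_1u_2\cdots u_i$ (the body) by adding four new vertices (the wings), two of them (the left wings) adjacent only to $u_1$ and the other two (the right wings) adjacent only to $u_i$. An $H$-graph is $H_i$, or the graph obtained from $H_i$ by joining the two left wings by an edge, or by joining the two right wings by an edge, or both. A canonical graph is a hole or an $H$-graph; its order is its number of vertices if it is a hole, and the number $i$ of vertices of its body if it is an $H$-graph. Theorem. For all natural numbers $s$ and $q$ there is a number $X=X(s,q)$ such that every graph of treewidth at least $X$ contains a canonical graph of order at least $s$ as an induced subgraph, or contains the complete bipartite graph $K_{q,q}$ as a (not necessarily induced) subgraph. -/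

import Mathlib

universe u v

namespace SimpleGraph

/-- A tree-decomposition of a graph `G`: a tree together with a bag of vertices of `G` at each of
its nodes, such that every vertex and every edge of `G` lies in some bag, and for each vertex the
nodes whose bags contain it induce a connected part of the tree. -/
structure TreeDecomposition {V : Type u} (G : SimpleGraph V) where
  Node : Type u
  tree : SimpleGraph Node
  isTree : tree.IsTree
  bag : Node → Set V
  exists_mem_bag : ∀ x : V, ∃ t, x ∈ bag t
  exists_edge_bag : ∀ x y : V, G.Adj x y → ∃ t, x ∈ bag t ∧ y ∈ bag t
  preconnected : ∀ x : V, (tree.induce {t | x ∈ bag t}).Preconnected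

/-- The width of a tree-decomposition: the largest size of a bag, minus one. -/
noncomputable def TreeDecomposition.width {V : Type u} {G : SimpleGraph V}
    (D : G.TreeDecomposition) : ℕ∞ :=
  (⨆ t : D.Node, (D.bag t).encard) - 1

/-- The tree-width of a graph: the least width of a tree-decomposition. -/
noncomputable def treewidth {V : Type u} (G : SimpleGraph V) : ℕ∞ :=
  ⨅ D : G.TreeDecomposition, D.width

/-- The graph `H_i` (if `l = r = false`), and the graphs obtained from it by joining the two left
wings (if `l = true`) and by joining the two right wings (if `r = true`).
The summand `Fin i` is the body, the first `Fin 2` holds the left wings and the second `Fin 2`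
holds the right wings. -/
def hGraph (i : ℕ) (l r : Bool) : SimpleGraph (Fin i ⊕ (Fin 2 ⊕ Fin 2)) :=
  SimpleGraph.fromRel fun x y =>
    match x, y with
    | .inl a, .inl b => a.val + 1 = b.val
    | .inl a, .inr (.inl _) => a.val = 0
    | .inl a, .inr (.inr _) => a.val + 1 = i
    | .inr (.inl _), .inr (.inl _) => l = true
    | .inr (.inr _), .inr (.inr _) => r = true
    | _, _ => False

/-- `H.IsCanonicalOfOrder m` says that `H` is a canonical graph of order `m`: either a hole, that is
a chordless cycle, with `m ≥ 4` vertices, or an `H`-graph (possibly semi-tight or tight) whose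
body, a path joining two distinct vertices, has `m ≥ 2` vertices. -/
inductive IsCanonicalOfOrder {W : Type v} (H : SimpleGraph W) : ℕ → Prop
  | hole (m : ℕ) (hm : 4 ≤ m) (e : Nonempty (H ≃g cycleGraph m)) : IsCanonicalOfOrder H m
  | hGraph (m : ℕ) (hm : 2 ≤ m) (l r : Bool) (e : Nonempty (H ≃g hGraph m l r)) :
      IsCanonicalOfOrder H m

end SimpleGraph

/-! Fix `G` with no `K_{q,q}` subgraph and no induced canonical subgraph of order at least `s`. The
claim, proved in `exists_forall_hasBags` by induction on `B`, is that every vertex set `B` induces a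
graph with a tree-decomposition into bags of size at most a constant depending only on `s` and `q`.

If all paths in `B` are short, the stacks of a depth-first search serve as bags. Otherwise
`exists_isIndPath_of_path` turns a long path into a long induced one: Gyárfás' argument gives either
such a path or many vertices dense on a common subpath. In the latter case Ramsey arguments, with
`K_{q,q}` excluded, select dense vertices as hubs and string them together.

Now take a longest induced path `p` in `B`. One vertex attached only near one end of `p` and another
attached only near the other end would give a long hole or a long `H`-graph
(`exists_isCanonicalOfOrder_of_far`); maximality is what supplies the remaining two wings. So, after
reversing `p` if necessary, every vertex attached to `p` has a neighbour far along it. Without long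
holes such a vertex is dense between any two of its neighbours (`isDenseOn_of_adj`), so few vertices
attach to an initial segment, as many of them would give `K_{q,q}`.

By pigeonhole some block of that segment contains no first neighbour of an attached vertex
(`HasBags.of_attached`). Let `S` be the set of vertices attached before that block. Contracting
pieces of the block turns `S` and one path vertex into a clique minor of a smaller induced subgraph,
which is decomposed by induction. The clique lies in one bag, and the deleted beginning of `p`,
attached only to `S`, is restored one vertex at a time (`HasBags.of_isDenseOn`). -/

namespace SimpleGraph

/-! ### Bag sequences: tree-decompositions listed with parents before children -/

/-- A sequence of bags whose members lie in `B`, have at most `w` elements, cover the vertices and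
edges of `G` in `B`, and satisfy the running intersection property. -/
structure IsBagSequence {V : Type u} (G : SimpleGraph V) (B : Set V) (w n : ℕ) (β : ℕ → Set V) :
    Prop where
  subset : ∀ i < n, β i ⊆ B
  encard_le : ∀ i < n, (β i).encard ≤ w
  exists_mem : ∀ x ∈ B, ∃ i < n, x ∈ β i
  exists_edge : ∀ x ∈ B, ∀ y ∈ B, G.Adj x y → ∃ i < n, x ∈ β i ∧ y ∈ β i
  rip : ∀ i < n, 0 < i → ∃ j < i, ∀ x ∈ β i, ∀ k < i, x ∈ β k → x ∈ β j

/-- The subgraph of `G` induced on `B` has a bag sequence with bags of size at most `w`, one of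
which contains `K`. -/
def HasBags {V : Type u} (G : SimpleGraph V) (B : Set V) (w : ℕ) (K : Set V) : Prop :=
  ∃ n β, IsBagSequence G B w n β ∧ ∃ i < n, K ⊆ β i

section Bags

variable {V : Type u} {G : SimpleGraph V} {B K : Set V} {w : ℕ}

theorem HasBags.mono_right {K' : Set V} (h : HasBags G B w K) (hK : K' ⊆ K) :
    HasBags G B w K' := by
  obtain ⟨n, β, h, i, hi, hKi⟩ := h
  exact ⟨n, β, h, i, hi, hK.trans hKi⟩

theorem HasBags.mono_width {w' : ℕ} (h : HasBags G B w K) (hw : w ≤ w') :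
    HasBags G B w' K := by
  obtain ⟨n, β, h, hK⟩ := h
  exact ⟨n, β, ⟨h.subset, fun i hi => (h.encard_le i hi).trans (by exact_mod_cast hw),
    h.exists_mem, h.exists_edge, h.rip⟩, hK⟩

theorem hasBags_empty : HasBags G ∅ w ∅ :=
  ⟨1, fun _ => ∅, ⟨by simp, by simp, by simp, by simp, by intro i hi h0; omega⟩, 0, by simp⟩

/-- Append `insert v K` as a last bag whose parent is the bag containing `K`. The vertex `v` occurs
in no earlier bag, so running intersection only concerns `K`. -/
theorem HasBags.add_vertex (h : HasBags G B w K) {v : V} (hv : v ∉ B)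
    (hN : ∀ x ∈ B, G.Adj v x → x ∈ K) (hK : K.encard + 1 ≤ w) :
    HasBags G (insert v B) w (insert v K) := by
  classical
  obtain ⟨n, β, h, t, ht, hKt⟩ := h
  have hlt : ∀ i < n, Function.update β n (Insert.insert v K) i = β i := fun i hi =>
    Function.update_of_ne hi.ne _ _
  have hn : Function.update β n (Insert.insert v K) n = Insert.insert v K :=
    Function.update_self ..
  have hKB : K ⊆ B := hKt.trans (h.subset t ht)
  refine ⟨n + 1, Function.update β n (Insert.insert v K), ⟨?_, ?_, ?_, ?_, ?_⟩, n, by omega,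
    hn.symm.subset⟩
  · intro i hi
    rcases Nat.lt_succ_iff_lt_or_eq.1 hi with hi | rfl
    · rw [hlt i hi]
      exact (h.subset i hi).trans (Set.subset_insert _ _)
    · rw [hn]
      exact Set.insert_subset_insert hKB
  · intro i hi
    rcases Nat.lt_succ_iff_lt_or_eq.1 hi with hi | rfl
    · rw [hlt i hi]
      exact h.encard_le i hi
    · rw [hn]
      exact (Set.encard_insert_le _ _).trans hK
  · rintro x (rfl | hx)
    · exact ⟨n, by omega, by rw [hn]; exact Set.mem_insert _ _⟩
    · obtain ⟨i, hi, hxi⟩ := h.exists_mem x hx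
      exact ⟨i, by omega, by rwa [hlt i hi]⟩
  · have key : ∀ x ∈ B, G.Adj v x → ∃ i < n + 1,
        v ∈ Function.update β n (Insert.insert v K) i ∧
        x ∈ Function.update β n (Insert.insert v K) i := fun x hx hvx =>
      ⟨n, by omega, by rw [hn]; exact ⟨Set.mem_insert _ _, Set.mem_insert_of_mem _ (hN x hx hvx)⟩⟩
    rintro x (rfl | hx) y (rfl | hy) hxy
    · exact absurd hxy (G.loopless.irrefl _)
    · exact key y hy hxy
    · obtain ⟨i, hi, h1, h2⟩ := key x hx hxy.symm
      exact ⟨i, hi, h2, h1⟩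
    · obtain ⟨i, hi, hxi⟩ := h.exists_edge x hx y hy hxy
      exact ⟨i, by omega, by rwa [hlt i hi]⟩
  · intro i hi h0
    rcases Nat.lt_succ_iff_lt_or_eq.1 hi with hi | rfl
    · obtain ⟨j, hj, hx⟩ := h.rip i hi h0
      refine ⟨j, hj, ?_⟩
      intro x hxi k hk hxk
      rw [hlt i hi] at hxi
      rw [hlt k (by omega)] at hxk
      rw [hlt j (by omega)]
      exact hx x hxi k hk hxk
    · refine ⟨t, ht, ?_⟩
      intro x hxi k hk hxk
      rw [hn] at hxi
      rw [hlt k hk] at hxk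
      rw [hlt t ht]
      rcases hxi with rfl | hxi
      · exact absurd (h.subset k hk hxk) hv
      · exact hKt hxi

/-- Depth-first search: if all paths in `B` are short, then `B` has a decomposition into small
bags. -/
theorem hasBags_of_forall_isChain_length_le {N : ℕ} (hB : B.Finite)
    (hN : ∀ l : List V, l.IsChain G.Adj → l.Nodup → (∀ x ∈ l, x ∈ B) → l.length ≤ N) :
    HasBags G B N ∅ := by
  -- State of the search: `C` is the set of unvisited vertices and `l` the stack, top first. The
  -- visited part is decomposed with the stack inside one bag, and visited neighbours of unvisited
  -- vertices are on the stack. A push and a pop each lower `2 * C.ncard + l.length` by one.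
  have main : ∀ m : ℕ, ∀ (C : Set V) (l : List V), C ⊆ B → 2 * C.ncard + l.length ≤ m →
      HasBags G (B \ C) N {x | x ∈ l} → l.IsChain G.Adj → l.Nodup → (∀ x ∈ l, x ∈ B \ C) →
      (∀ x ∈ C, ∀ y ∈ B, G.Adj x y → y ∈ C ∨ y ∈ l) → HasBags G B N ∅ := by
    intro m
    induction m with
    | zero =>
      intro C l hC hm h _ _ _ _
      have hC0 : C = ∅ := (Set.ncard_eq_zero (hB.subset hC)).1 (by omega)
      subst hC0
      simpa using h.mono_right (Set.empty_subset _)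
    | succ m ih =>
      intro C l hC hm h hl hnd hlB hCN
      -- The visited neighbours of `c` are all on the stack, so `c` together with the stack is a
      -- legitimate new bag; it is the vertex set of a path, hence has at most `N` elements.
      have push : ∀ c ∈ C, (c :: l).IsChain G.Adj → HasBags G B N ∅ := by
        intro c hc hcl
        have hcl' : c ∉ l := fun hcl' => (hlB c hcl').2 hc
        have hnd' : (c :: l).Nodup := List.nodup_cons.2 ⟨hcl', hnd⟩
        have hlen : (c :: l).length ≤ N := hN _ hcl hnd' (by
          intro x hx
          rcases List.mem_cons.1 hx with rfl | hx
          · exact hC hc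
          · exact (hlB x hx).1)
        have hset : B \ (C \ {c}) = insert c (B \ C) := by
          ext x
          by_cases hxc : x = c
          · subst hxc; simp [hC hc]
          · simp [hxc]
        have hcard : (C \ {c}).ncard + 1 = C.ncard :=
          Set.ncard_sdiff_singleton_add_one hc (hB.subset hC)
        refine ih (C \ {c}) (c :: l) (Set.sdiff_subset.trans hC) (by
          simp only [List.length_cons]; omega) ?_ hcl hnd' ?_ ?_
        · rw [hset]
          have := h.add_vertex (v := c) (fun hh => hh.2 hc) (fun x hx hcx =>
            (hCN c hc x hx.1 hcx).resolve_left hx.2) ?_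
          · refine this.mono_right ?_
            intro x hx
            rcases List.mem_cons.1 hx with rfl | hx
            · exact Set.mem_insert _ _
            · exact Set.mem_insert_of_mem _ hx
          · classical
            have : {x | x ∈ l} = ((l.toFinset : Finset V) : Set V) := by ext; simp
            rw [this, Set.encard_coe_eq_coe_finsetCard, List.toFinset_card_of_nodup hnd]
            simp only [List.length_cons] at hlen
            exact_mod_cast hlen
        · intro x hx
          rw [hset]
          rcases List.mem_cons.1 hx with rfl | hx
          · exact Set.mem_insert _ _
          · exact Set.mem_insert_of_mem _ (hlB x hx)
        · intro x hx y hy hxy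
          by_cases hyc : y = c
          · exact Or.inr (by simp [hyc])
          · rcases hCN x hx.1 y hy hxy with h1 | h1
            · exact Or.inl ⟨h1, hyc⟩
            · exact Or.inr (List.mem_cons_of_mem _ h1)
      cases l with
      | nil =>
        by_cases hC0 : C = ∅
        · subst hC0
          simpa using h.mono_right (Set.empty_subset _)
        · obtain ⟨c, hc⟩ := Set.nonempty_iff_ne_empty.2 hC0
          exact push c hc (by simp)
      | cons a l =>
        by_cases hac : ∃ c ∈ C, G.Adj a c
        · obtain ⟨c, hc, hac⟩ := hac
          exact push c hc (List.isChain_cons_cons.2 ⟨hac.symm, hl⟩)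
        · push Not at hac
          refine ih C l hC (by simp only [List.length_cons] at hm; omega)
            (h.mono_right fun x hx => List.mem_cons_of_mem _ hx) hl.tail
            (List.nodup_cons.1 hnd).2 (fun x hx => hlB x (List.mem_cons_of_mem _ hx)) ?_
          intro x hx y hy hxy
          rcases hCN x hx y hy hxy with h1 | h1
          · exact Or.inl h1
          · rcases List.mem_cons.1 h1 with rfl | h1
            · exact absurd hxy.symm (hac x hx)
            · exact Or.inr h1
  refine main (2 * B.ncard) B [] subset_rfl (by simp) ?_ (by simp) (by simp) (by simp)
    (fun x _ y hy _ => Or.inl hy)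
  simpa using (hasBags_empty : HasBags G ∅ N ∅)

/-- In a bag sequence, a set of vertices any two of which share a bag lies in a single bag. -/
theorem exists_subset_bag_of_pairwise {β : ℕ → Set V} : ∀ n : ℕ,
    (∀ i < n, 0 < i → ∃ j < i, ∀ x ∈ β i, ∀ k < i, x ∈ β k → x ∈ β j) →
    ∀ K : Set V, K.Nonempty → (∀ x ∈ K, ∀ y ∈ K, ∃ i < n, x ∈ β i ∧ y ∈ β i) →
    ∃ i < n, K ⊆ β i := by
  intro n
  induction n with
  | zero =>
    rintro - K ⟨x, hx⟩ h
    obtain ⟨i, hi, -⟩ := h x hx x hx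
    omega
  | succ n ih =>
    intro hrip K hK h
    -- A member of `K` occurring only in the last bag forces all of `K` into that bag. Otherwise any
    -- two members that meet in the last bag also meet in its parent, and the last bag can be
    -- dropped.
    by_cases hnew : ∃ x ∈ K, ∀ k < n, x ∉ β k
    · obtain ⟨x, hx, hxn⟩ := hnew
      refine ⟨n, by omega, fun y hy => ?_⟩
      obtain ⟨i, hi, hxi, hyi⟩ := h x hx y hy
      rcases Nat.lt_succ_iff_lt_or_eq.1 hi with hi | rfl
      · exact absurd hxi (hxn i hi)
      · exact hyi
    · push Not at hnew
      obtain ⟨i, hi, hKi⟩ := ih (fun i hi => hrip i (by omega)) K hK (by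
        intro x hx y hy
        obtain ⟨i, hi, hxi, hyi⟩ := h x hx y hy
        rcases Nat.lt_succ_iff_lt_or_eq.1 hi with hi | rfl
        · exact ⟨i, hi, hxi, hyi⟩
        · obtain ⟨k, hk, hxk⟩ := hnew x hx
          obtain ⟨l, hl, hyl⟩ := hnew y hy
          obtain ⟨j, hj, hj'⟩ := hrip i (by omega) (by omega)
          exact ⟨j, hj, hj' x hxi k hk hxk, hj' y hyi l hl hyl⟩)
      exact ⟨i, by omega, hKi⟩

/-- A set connected through the bags of a bag sequence stays connected through each initial
segment of the sequence. -/
theorem reflTransGen_bag_succ {β : ℕ → Set V} {i : ℕ} {C : Set V}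
    (hrip : 0 < i → ∃ j < i, ∀ x ∈ β i, ∀ k < i, x ∈ β k → x ∈ β j) {x y : V}
    (hx : ∃ k < i, x ∈ β k) (hy : ∃ k < i, y ∈ β k)
    (h : Relation.ReflTransGen
      (fun a b => a ∈ C ∧ b ∈ C ∧ ∃ k < i + 1, a ∈ β k ∧ b ∈ β k) x y) :
    Relation.ReflTransGen (fun a b => a ∈ C ∧ b ∈ C ∧ ∃ k < i, a ∈ β k ∧ b ∈ β k) x y := by
  obtain ⟨k0, hk0, hxk0⟩ := hx
  obtain ⟨j, hj, hj'⟩ := hrip (by omega)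
  -- The walk may pass through vertices lying only in bag `i`. The induction therefore tracks every
  -- earlier `z` that equals the current endpoint or shares bag `i` with it, so that a detour
  -- through bag `i` is replaced by a step in the parent `j`.
  have main : ∀ z : V, (∃ k < i, z ∈ β k) → (z = y ∨ z ∈ C ∧ y ∈ C ∧ z ∈ β i ∧ y ∈ β i) →
      Relation.ReflTransGen (fun a b => a ∈ C ∧ b ∈ C ∧ ∃ k < i, a ∈ β k ∧ b ∈ β k) x z := by
    clear hy
    induction h with
    | refl =>
      rintro z ⟨k, hk, hzk⟩ (rfl | ⟨hzC, hxC, hzi, hxi⟩)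
      · exact .refl
      · exact .single ⟨hxC, hzC, j, hj, hj' x hxi k0 hk0 hxk0, hj' z hzi k hk hzk⟩
    | @tail b c _ hbc ih =>
      obtain ⟨hbC, hcC, k, hk, hbk, hck⟩ := hbc
      rintro z ⟨l, hl, hzl⟩ hz
      rcases Nat.lt_succ_iff_lt_or_eq.1 hk with hk | rfl
      · have hc := (ih b ⟨k, hk, hbk⟩ (Or.inl rfl)).tail ⟨hbC, hcC, k, hk, hbk, hck⟩
        rcases hz with rfl | ⟨hzC, -, hzi, hci⟩
        · exact hc
        · exact hc.tail ⟨hcC, hzC, j, hj, hj' c hci k hk hck, hj' z hzi l hl hzl⟩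
      · rcases hz with rfl | ⟨hzC, -, hzi, hci⟩
        · exact ih z ⟨l, hl, hzl⟩ (Or.inr ⟨hcC, hbC, hck, hbk⟩)
        · exact ih z ⟨l, hl, hzl⟩ (Or.inr ⟨hzC, hbC, hzi, hbk⟩)
  exact main y hy (Or.inl rfl)

theorem reflTransGen_bag_of_le {β : ℕ → Set V} {i n : ℕ} {C : Set V} (hin : i ≤ n)
    (hrip : ∀ i < n, 0 < i → ∃ j < i, ∀ x ∈ β i, ∀ k < i, x ∈ β k → x ∈ β j) {x y : V}
    (hx : ∃ k < i, x ∈ β k) (hy : ∃ k < i, y ∈ β k)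
    (h : Relation.ReflTransGen
      (fun a b => a ∈ C ∧ b ∈ C ∧ ∃ k < n, a ∈ β k ∧ b ∈ β k) x y) :
    Relation.ReflTransGen (fun a b => a ∈ C ∧ b ∈ C ∧ ∃ k < i, a ∈ β k ∧ b ∈ β k) x y := by
  induction n, hin using Nat.le_induction with
  | base => exact h
  | succ n hn ih =>
    refine ih (fun i hi => hrip i (by omega)) (reflTransGen_bag_succ (hrip n (by omega)) ?_ ?_ h)
    · obtain ⟨k, hk, hxk⟩ := hx
      exact ⟨k, by omega, hxk⟩
    · obtain ⟨k, hk, hyk⟩ := hy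
      exact ⟨k, by omega, hyk⟩

/-- The running intersection property is kept when connected sets of vertices are contracted. -/
theorem rip_image {W : Type v} {β : ℕ → Set V} {n : ℕ} {φ : V → W}
    (hrip : ∀ i < n, 0 < i → ∃ j < i, ∀ x ∈ β i, ∀ k < i, x ∈ β k → x ∈ β j)
    (hconn : ∀ i < n, ∀ j < n, ∀ x ∈ β i, ∀ y ∈ β j, φ x = φ y → Relation.ReflTransGen
      (fun a b => φ a = φ x ∧ φ b = φ x ∧ ∃ k < n, a ∈ β k ∧ b ∈ β k) x y) :
    ∀ i < n, 0 < i → ∃ j < i, ∀ x ∈ φ '' β i, ∀ k < i, x ∈ φ '' β k → x ∈ φ '' β j := by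
  intro i hi h0
  obtain ⟨j, hj, hj'⟩ := hrip i hi h0
  refine ⟨j, hj, ?_⟩
  rintro _ ⟨x, hx, rfl⟩ k hk ⟨y, hy, hyx⟩
  have h1 := hconn k (by omega) i hi y hy x hx hyx
  have h2 := reflTransGen_bag_of_le (C := {a | φ a = φ y}) (i := i + 1) (by omega) hrip
    ⟨k, by omega, hy⟩ ⟨i, by omega, hx⟩ h1
  -- A member `z` of the fibre lying both in bag `i` and in an earlier bag lies in the parent.
  -- Follow a walk in the fibre from `y` to `x`: the first step that needs bag `i` starts at such a
  -- `z`, and if no step needs it, `x` itself will do.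
  suffices hz : ∃ z, φ z = φ x ∧ z ∈ β i ∧ ∃ k < i, z ∈ β k by
    obtain ⟨z, hzx, hzi, l, hl, hzl⟩ := hz
    exact ⟨z, hj' z hzi l hl hzl, hzx⟩
  have main : ∀ b, Relation.ReflTransGen (fun a b => a ∈ {a | φ a = φ y} ∧ b ∈ {a | φ a = φ y} ∧
      ∃ k < i + 1, a ∈ β k ∧ b ∈ β k) y b →
      (∃ k < i, b ∈ β k) ∨ ∃ z, φ z = φ x ∧ z ∈ β i ∧ ∃ k < i, z ∈ β k := by
    intro b hb
    induction hb with
    | refl => exact Or.inl ⟨k, hk, hy⟩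
    | @tail b c _ hbc ih =>
      rcases ih with ih | ih
      · obtain ⟨hb, hc, l, hl, hbl, hcl⟩ := hbc
        rcases Nat.lt_succ_iff_lt_or_eq.1 hl with hl | rfl
        · exact Or.inl ⟨l, hl, hcl⟩
        · exact Or.inr ⟨b, hb.trans hyx, hbl, ih⟩
      · exact Or.inr ih
  rcases main x h2 with h3 | h3
  · exact ⟨x, rfl, hx, h3⟩
  · exact h3

end Bags

/-! ### From bag sequences to treewidth -/

/-- A bag sequence for the whole graph yields a tree-decomposition. -/
theorem treewidth_lt_of_hasBags {V : Type u} {G : SimpleGraph V} {w : ℕ} (hw : 0 < w)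
    (h : HasBags G Set.univ w ∅) : G.treewidth < w := by
  obtain ⟨n, β, h, t, ht, -⟩ := h
  have hrip : ∀ i : Fin n, ∃ j : Fin n, 0 < i.1 → j < i ∧ ∀ x ∈ β i, ∀ k < i, x ∈ β k → x ∈ β j := by
    intro i
    by_cases h0 : 0 < i.1
    · obtain ⟨j, hj, hj'⟩ := h.rip i i.2 h0
      exact ⟨⟨j, by omega⟩, fun _ => ⟨hj, fun x hx k hk hxk => hj' x hx k hk hxk⟩⟩
    · exact ⟨i, fun h => absurd h h0⟩
  choose par hpar using hrip
  let T : SimpleGraph (ULift.{u} (Fin n)) :=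
    SimpleGraph.fromRel fun a b => 0 < a.down.1 ∧ b.down = par a.down
  have hadj : ∀ i : Fin n, 0 < i.1 → T.Adj ⟨i⟩ ⟨par i⟩ := by
    intro i hi
    refine ⟨?_, Or.inl ⟨hi, rfl⟩⟩
    intro he
    have := (hpar i hi).1
    have he' : i = par i := congrArg ULift.down he
    exact absurd this (by rw [← he']; exact lt_irrefl _)
  have hconn : ∀ i : Fin n, T.Reachable ⟨i⟩ ⟨⟨0, by omega⟩⟩ := by
    intro i
    induction i using WellFoundedLT.induction with
    | _ i ih =>
      by_cases h0 : 0 < i.1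
      · exact (hadj i h0).reachable.trans (ih _ (hpar i h0).1)
      · have : i = ⟨0, by omega⟩ := Fin.ext (by simpa using h0)
        rw [← this]
  have hTc : T.Connected := by
    have : Nonempty (ULift.{u} (Fin n)) := ⟨⟨⟨t, ht⟩⟩⟩
    exact ⟨fun a b => (hconn a.down).trans (hconn b.down).symm⟩
  -- `T` is connected, and each edge comes from a positive index and its parent, so there are at
  -- most `n - 1` edges.
  have htree : T.IsTree := by
    rw [isTree_iff_connected_and_card]
    refine ⟨hTc, ?_⟩
    have h1 := hTc.card_vert_le_card_edgeSet_add_one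
    have h2 : T.edgeSet ⊆ (fun i : Fin n => s((⟨i⟩ : ULift.{u} (Fin n)), ⟨par i⟩)) ''
        {i | 0 < i.1} := by
      intro e
      induction e with
      | _ a b =>
        rintro ⟨-, ⟨h0, hb⟩ | ⟨h0, hb⟩⟩
        · obtain rfl : b = ⟨par a.down⟩ := congrArg ULift.up hb
          exact ⟨a.down, h0, rfl⟩
        · obtain rfl : a = ⟨par b.down⟩ := congrArg ULift.up hb
          exact ⟨b.down, h0, Sym2.eq_swap⟩
    have h3 : T.edgeSet.ncard ≤ ({i | 0 < i.1} : Set (Fin n)).ncard :=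
      (Set.ncard_le_ncard h2).trans (Set.ncard_image_le)
    have h4 : ({i | 0 < i.1} : Set (Fin n)).ncard < n := by
      have : ({i | 0 < i.1} : Set (Fin n)) ⊂ Set.univ :=
        (Set.ssubset_univ_iff).2 fun he => by
          have : (⟨0, by omega⟩ : Fin n) ∈ ({i | 0 < i.1} : Set (Fin n)) := he ▸ Set.mem_univ _
          simp at this
      simpa using Set.ncard_lt_ncard this
    have h5 : Nat.card (ULift.{u} (Fin n)) = n := by simp
    rw [Nat.card_coe_set_eq] at h1 ⊢
    omega
  have hpre : ∀ x : V, (T.induce {t : ULift.{u} (Fin n) | x ∈ β t.down.1}).Preconnected := by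
    intro x
    -- Starting at any node whose bag contains `x` and passing to parents, running intersection
    -- keeps `x` in the bag until the least such node is reached.
    suffices hmin : ∃ m : {t : ULift.{u} (Fin n) | x ∈ β t.down.1},
        ∀ i : Fin n, ∀ hi : x ∈ β i, (T.induce {t : ULift.{u} (Fin n) | x ∈ β t.down.1}).Reachable ⟨⟨i⟩, hi⟩ m by
      obtain ⟨m, hm⟩ := hmin
      exact fun a b => (hm a.1.down a.2).trans (hm b.1.down b.2).symm
    classical
    obtain ⟨k, hk, hxk⟩ := h.exists_mem x trivial
    have hex : ∃ k, k < n ∧ x ∈ β k := ⟨k, hk, hxk⟩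
    have hm := Nat.find_spec hex
    refine ⟨⟨⟨⟨Nat.find hex, hm.1⟩⟩, hm.2⟩, ?_⟩
    intro i
    induction i using WellFoundedLT.induction with
    | _ i ih =>
      intro hi
      by_cases h0 : Nat.find hex < i.1
      · have hp := hpar i (by omega)
        have hxp := hp.2 x hi ⟨Nat.find hex, hm.1⟩ h0 hm.2
        have : (T.induce {t : ULift.{u} (Fin n) | x ∈ β t.down.1}).Adj ⟨⟨i⟩, hi⟩ ⟨⟨par i⟩, hxp⟩ := hadj i (by omega)
        exact this.reachable.trans (ih _ hp.1 hxp)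
      · have h1 : Nat.find hex ≤ i.1 := Nat.find_min' hex ⟨i.2, hi⟩
        have : i = ⟨Nat.find hex, hm.1⟩ := Fin.ext (by simp only; omega)
        subst this
        exact Reachable.refl _
  let D : G.TreeDecomposition :=
    { Node := ULift.{u} (Fin n)
      tree := T
      isTree := htree
      bag := fun t => β t.down
      exists_mem_bag := fun x => by
        obtain ⟨i, hi, hx⟩ := h.exists_mem x trivial
        exact ⟨⟨⟨i, hi⟩⟩, hx⟩
      exists_edge_bag := fun x y hxy => by
        obtain ⟨i, hi, hx⟩ := h.exists_edge x trivial y trivial hxy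
        exact ⟨⟨⟨i, hi⟩⟩, hx⟩
      preconnected := hpre }
  have hD : D.width ≤ (w - 1 : ℕ) := by
    unfold TreeDecomposition.width
    have : (⨆ t : D.Node, (D.bag t).encard) ≤ w := iSup_le fun t => h.encard_le _ t.down.2
    calc (⨆ t : D.Node, (D.bag t).encard) - 1 ≤ (w : ℕ∞) - 1 := tsub_le_tsub_right this 1
      _ = ((w - 1 : ℕ) : ℕ∞) := by simp
  calc G.treewidth ≤ D.width := iInf_le _ D
    _ ≤ (w - 1 : ℕ) := hD
    _ < w := by exact_mod_cast Nat.sub_lt hw one_pos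

/-! ### Induced paths and geodesics -/

section InducedPaths

variable {V : Type u} {G : SimpleGraph V}

/-- `p 0, …, p (m - 1)` is an induced path of `G`. -/
def IsIndPath (G : SimpleGraph V) (p : ℕ → V) (m : ℕ) : Prop :=
  ∀ i j, i < j → j < m → p i ≠ p j ∧ (G.Adj (p i) (p j) ↔ j = i + 1)

theorem IsIndPath.mono {p : ℕ → V} {m m' : ℕ} (h : IsIndPath G p m) (hm : m' ≤ m) :
    IsIndPath G p m' := fun i j hij hj => h i j hij (hj.trans_le hm)

theorem IsIndPath.shift {p : ℕ → V} {m m' a : ℕ} (h : IsIndPath G p m) (hm : a + m' ≤ m) :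
    IsIndPath G (fun i => p (a + i)) m' := fun i j hij hj =>
  ⟨(h (a + i) (a + j) (by omega) (by omega)).1,
    (h (a + i) (a + j) (by omega) (by omega)).2.trans (by omega)⟩

theorem IsIndPath.reverse {p : ℕ → V} {m : ℕ} (h : IsIndPath G p m) :
    IsIndPath G (fun i => p (m - 1 - i)) m := by
  intro i j hij hj
  have := h (m - 1 - j) (m - 1 - i) (by omega) (by omega)
  exact ⟨this.1.symm, by rw [G.adj_comm, this.2]; omega⟩

theorem IsIndPath.cons {p : ℕ → V} {m : ℕ} {x : V} (h : IsIndPath G p m)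
    (hx : ∀ i < m, x ≠ p i) (hadj : ∀ i < m, G.Adj x (p i) ↔ i = 0) :
    IsIndPath G (fun i => Nat.casesOn i x p) (m + 1) := by
  intro i j hij hj
  obtain ⟨j, rfl⟩ : ∃ k, j = k + 1 := ⟨j - 1, by omega⟩
  cases i with
  | zero => exact ⟨hx j (by omega), (hadj j (by omega)).trans (by simp)⟩
  | succ i =>
    have := h i j (by omega) (by omega)
    exact ⟨this.1, this.2.trans (by simp)⟩

theorem IsIndPath.injOn {p : ℕ → V} {m : ℕ} (h : IsIndPath G p m) {i j : ℕ} (hi : i < m)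
    (hj : j < m) (hij : p i = p j) : i = j := by
  rcases lt_trichotomy i j with h1 | h1 | h1
  · exact absurd hij (h i j h1 hj).1
  · exact h1
  · exact absurd hij.symm (h j i h1 hi).1

theorem IsIndPath.adj_iff {p : ℕ → V} {m : ℕ} (h : IsIndPath G p m) {i j : ℕ} (hi : i < m)
    (hj : j < m) : G.Adj (p i) (p j) ↔ j = i + 1 ∨ i = j + 1 := by
  rcases lt_trichotomy i j with h1 | h1 | h1
  · rw [(h i j h1 hj).2]; omega
  · subst h1; simp
  · rw [G.adj_comm, (h j i h1 hi).2]; omega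

theorem IsIndPath.le_card [Finite V] {p : ℕ → V} {m : ℕ} (h : IsIndPath G p m) :
    m ≤ Nat.card V := by
  have : Function.Injective fun i : Fin m => p i := fun i j hij =>
    Fin.ext (h.injOn i.2 j.2 hij)
  simpa using Nat.card_le_card_of_injective _ this

/-- The spanning subgraph of `G` formed by the edges inside `U`. -/
def inside (G : SimpleGraph V) (U : Set V) : SimpleGraph V where
  Adj a b := G.Adj a b ∧ a ∈ U ∧ b ∈ U
  symm := ⟨fun _ _ h => ⟨h.1.symm, h.2.2, h.2.1⟩⟩
  loopless := ⟨fun _ h => G.loopless.irrefl _ h.1⟩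

theorem inside_mono {U U' : Set V} (h : U ⊆ U') : inside G U ≤ inside G U' :=
  fun _ _ hab => ⟨hab.1, h hab.2.1, h hab.2.2⟩

/-- A geodesic inside a set is an induced path. -/
theorem exists_isIndPath_of_reachable_inside {U : Set V} {x y : V} (hx : x ∈ U)
    (h : (inside G U).Reachable x y) :
    ∃ p m, IsIndPath G p (m + 1) ∧ p 0 = x ∧ p m = y ∧ ∀ i ≤ m, p i ∈ U := by
  obtain ⟨P, hP⟩ := h.exists_walk_length_eq_dist
  have hU : ∀ i ≤ P.length, P.getVert i ∈ U := by
    intro i hi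
    cases i with
    | zero => simpa using hx
    | succ i => exact (P.adj_getVert_succ (by omega : i < P.length)).2.2
  have hpath := P.isPath_of_length_eq_dist hP
  refine ⟨P.getVert, P.length, ?_, by simp, by simp, hU⟩
  intro i j hij hj
  refine ⟨fun he => ?_, fun hadj => ?_, ?_⟩
  · have := hpath.getVert_injOn (by simp; omega) (by simp; omega) he
    omega
  -- A chord stays inside `U`, so it would shortcut the walk below the distance unless it joins
  -- consecutive vertices.
  · have ha : (inside G U).Adj (P.getVert i) (P.getVert j) :=
      ⟨hadj, hU i (by omega), hU j (by omega)⟩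
    have := dist_le (((P.take i).append (Walk.cons ha Walk.nil)).append (P.drop j))
    simp only [Walk.length_append, Walk.length_cons, Walk.length_nil, Walk.take_length,
      Walk.drop_length] at this
    omega
  · rintro rfl
    exact (P.adj_getVert_succ (by omega : i < P.length)).1

end InducedPaths

/-! ### Finding `K_{q,q}` between families of small sets -/

section CompleteBipartite

variable {V : Type u} {G : SimpleGraph V}

theorem isContained_completeBipartiteGraph_of_finset {q : ℕ} {S T : Finset V} (hS : q ≤ S.card)
    (hT : q ≤ T.card) (h : ∀ x ∈ S, ∀ y ∈ T, G.Adj x y) :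
    IsContained (completeBipartiteGraph (Fin q) (Fin q)) G := by
  obtain ⟨a⟩ := Function.Embedding.nonempty_of_card_le (α := Fin q) (β := S) (by simpa using hS)
  obtain ⟨b⟩ := Function.Embedding.nonempty_of_card_le (α := Fin q) (β := T) (by simpa using hT)
  refine ⟨⟨⟨Sum.elim (fun i => (a i : V)) fun i => (b i : V), ?_⟩, ?_⟩⟩
  · rintro (i | i) (j | j) hij
    · simp at hij
    · exact h _ (a i).2 _ (b j).2
    · exact (h _ (a j).2 _ (b i).2).symm
    · simp at hij
  · rintro (i | i) (j | j) hij
    · exact congrArg Sum.inl (a.injective (Subtype.ext hij))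
    · have := h _ (a i).2 _ (b j).2
      exact absurd (show (_ : V) = _ from hij) (by simpa using G.ne_of_adj this)
    · have := h _ (a j).2 _ (b i).2
      exact absurd (show (_ : V) = _ from hij) (by simpa using (G.ne_of_adj this).symm)
    · exact congrArg Sum.inr (b.injective (Subtype.ext hij))

/-- Two large families of disjoint small sets, such that every member of one family touches every
member of the other, yield a complete bipartite subgraph. -/
theorem isContained_completeBipartiteGraph_of_families {ι κ : Type*} {q n : ℕ} (hq : 0 < q)
    (hn : 0 < n) {I : Finset ι} {J : Finset κ} {A : ι → Finset V} {B : κ → Finset V}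
    (hA : ∀ i ∈ I, ∀ i' ∈ I, ∀ x ∈ A i, x ∈ A i' → i = i')
    (hB : ∀ j ∈ J, ∀ j' ∈ J, ∀ x ∈ B j, x ∈ B j' → j = j')
    (hAn : ∀ i ∈ I, (A i).card ≤ n) (hBn : ∀ j ∈ J, (B j).card ≤ n)
    (hI : q * n ≤ I.card) (hJ : q * (n ^ I.card * 2 ^ I.card) ≤ J.card)
    (h : ∀ i ∈ I, ∀ j ∈ J, ∃ x ∈ A i, ∃ y ∈ B j, G.Adj x y) :
    IsContained (completeBipartiteGraph (Fin q) (Fin q)) G := by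
  classical
  have h' : ∀ (i : I) (j : J), ∃ x y, x ∈ A i ∧ y ∈ B j ∧ G.Adj x y := fun i j => by
    obtain ⟨x, hx, y, hy, hxy⟩ := h i i.2 j j.2
    exact ⟨x, y, hx, hy, hxy⟩
  choose x y hx hy hxy using h'
  have hI0 : 0 < I.card := (Nat.mul_pos hq hn).trans_le hI
  obtain ⟨i0, hi0⟩ := Finset.card_pos.1 hI0
  -- The edges chosen from the `|I| ≥ q * n` sets `A i` to `B j` end in at most `n` vertices, so one
  -- vertex `z j` receives at least `q` of them.
  have hz : ∀ j : J, ∃ z ∈ B j, q ≤ (Finset.univ.filter fun i : I => y i j = z).card := by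
    intro j
    refine Finset.exists_le_card_fiber_of_mul_le_card_of_maps_to (fun i _ => hy i j)
      ⟨_, hy ⟨i0, hi0⟩ j⟩ ?_
    rw [Finset.card_univ, Fintype.card_coe]
    exact ((Nat.mul_le_mul_right q (hBn j j.2)).trans (by rw [mul_comm])).trans hI
  choose z hzB hzq using hz
  -- The type of `j` records the ends of its edges in the sets `A i` and which of these edges reach
  -- `z j`. Then `q` indices of equal type have a common set of at least `q` vertices adjacent to
  -- all their `z j`.
  let F : J → (I → V) × Finset I := fun j => (fun i => x i j, Finset.univ.filter fun i => y i j = z j)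
  let T : Finset ((I → V) × Finset I) := Fintype.piFinset (fun i : I => A i) ×ˢ Finset.univ
  have hFT : ∀ j ∈ Finset.univ, F j ∈ T := fun j _ => by
    simp only [F, T, Finset.mem_product, Fintype.mem_piFinset, Finset.mem_univ, and_true]
    exact fun i => hx i j
  have hTc : T.card ≤ n ^ I.card * 2 ^ I.card := by
    rw [Finset.card_product, Fintype.card_piFinset, Finset.card_univ, Fintype.card_finset,
      Fintype.card_coe]
    refine Nat.mul_le_mul_right _ ?_
    calc ∏ i : I, (A i).card ≤ ∏ _i : I, n := Finset.prod_le_prod' fun i _ => hAn i i.2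
      _ = n ^ I.card := by simp
  have hJ0 : 0 < J.card := lt_of_lt_of_le (by positivity) hJ
  obtain ⟨j0, hj0⟩ := Finset.card_pos.1 hJ0
  obtain ⟨t, -, ht⟩ := Finset.exists_le_card_fiber_of_mul_le_card_of_maps_to (n := q) hFT
    ⟨_, hFT ⟨j0, hj0⟩ (Finset.mem_univ _)⟩ (by
      rw [Finset.card_univ, Fintype.card_coe]
      exact ((Nat.mul_le_mul_right q hTc).trans (by rw [mul_comm])).trans hJ)
  set J' := Finset.univ.filter fun j => F j = t with hJ'
  have hJ'0 : 0 < J'.card := hq.trans_le ht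
  obtain ⟨j1, hj1⟩ := Finset.card_pos.1 hJ'0
  have hF : ∀ j ∈ J', F j = F j1 := fun j hj => by
    rw [(Finset.mem_filter.1 hj).2, (Finset.mem_filter.1 hj1).2]
  refine isContained_completeBipartiteGraph_of_finset
    (S := (Finset.univ.filter fun i : I => y i j1 = z j1).image fun i => x i j1)
    (T := J'.image z) ?_ ?_ ?_
  · rw [Finset.card_image_of_injective _ fun i i' hii' =>
      Subtype.ext (hA i i.2 i' i'.2 _ (hx i j1) (by simpa only [hii'] using hx i' j1))]
    exact hzq j1
  · rw [Finset.card_image_of_injective _ fun j j' hjj' =>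
      Subtype.ext (hB j j.2 j' j'.2 _ (hzB j) (by simpa only [hjj'] using hzB j'))]
    exact ht
  · intro a ha b hb
    obtain ⟨i, hi, rfl⟩ := Finset.mem_image.1 ha
    obtain ⟨j, hj, rfl⟩ := Finset.mem_image.1 hb
    have h1 : x i j = x i j1 := congrFun (congrArg Prod.fst (hF j hj)) i
    have h2 : i ∈ Finset.univ.filter fun i => y i j = z j := by
      have : (Finset.univ.filter fun i => y i j = z j) = Finset.univ.filter fun i => y i j1 = z j1 :=
        congrArg Prod.snd (hF j hj)
      rw [this]
      exact hi
    rw [← h1, ← (Finset.mem_filter.1 h2).2]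
    exact hxy i j

end CompleteBipartite

/-! ### Assembling holes and `H`-graphs -/

section Canonical

variable {V : Type u} {G : SimpleGraph V}

/-- An induced path together with a vertex adjacent to exactly its two ends forms a hole. -/
theorem exists_isCanonicalOfOrder_of_hole {p : ℕ → V} {m : ℕ} {x : V} (h : IsIndPath G p m)
    (hm : 3 ≤ m) (hx : ∀ i < m, x ≠ p i) (hadj : ∀ i < m, G.Adj x (p i) ↔ i = 0 ∨ i + 1 = m) :
    ∃ A : Set V, (G.induce A).IsCanonicalOfOrder (m + 1) := by
  let c : Fin (m + 1) → V := fun i => Nat.casesOn i.1 x p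
  have key : ∀ i j : Fin (m + 1), i < j →
      c i ≠ c j ∧ (G.Adj (c i) (c j) ↔ (cycleGraph (m + 1)).Adj i j) := by
    rintro ⟨i, hi⟩ ⟨j, hj⟩ hij
    have hij' : i < j := hij
    have h1 : ((⟨j, hj⟩ : Fin (m + 1)) - ⟨i, hi⟩).1 = j - i :=
      Fin.sub_val_of_le hij.le
    have h2 : ((⟨i, hi⟩ : Fin (m + 1)) - ⟨j, hj⟩).1 = m + 1 + i - j :=
      Fin.coe_sub_iff_lt.2 hij
    rw [cycleGraph_adj', h1, h2]
    obtain ⟨j, rfl⟩ : ∃ k, j = k + 1 := ⟨j - 1, by omega⟩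
    cases i with
    | zero => exact ⟨hx j (by omega), (hadj j (by omega)).trans (by omega)⟩
    | succ i =>
      have := h i j (by omega) (by omega)
      exact ⟨this.1, this.2.trans (by omega)⟩
  have hinj : Function.Injective c := by
    intro i j hij
    rcases lt_trichotomy i j with h1 | h1 | h1
    · exact absurd hij (key i j h1).1
    · exact h1
    · exact absurd hij.symm (key j i h1).1
  let e : cycleGraph (m + 1) ↪g G :=
    { toFun := c
      inj' := hinj
      map_rel_iff' := by
        intro i j
        rcases lt_trichotomy i j with h1 | h1 | h1
        · exact (key i j h1).2
        · subst h1; simp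
        · rw [G.adj_comm, (cycleGraph (m + 1)).adj_comm]
          exact (key j i h1).2 }
  exact ⟨_, .hole (m + 1) (by omega) ⟨e.isoInduceRange.symm⟩⟩

/-- Two vertices attached near the ends of an induced path produce an `H`-graph whose body is the
path without its two end vertices. -/
theorem exists_isCanonicalOfOrder_of_wings {p : ℕ → V} {k : ℕ} {x y : V}
    (h : IsIndPath G p (k + 2)) (hk : 2 ≤ k) (hx : ∀ i < k + 2, x ≠ p i)
    (hy : ∀ i < k + 2, y ≠ p i) (hxy : x ≠ y) (hnxy : ¬ G.Adj x y) (hx1 : G.Adj x (p 1))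
    (hxp : ∀ i, 1 < i → i < k + 2 → ¬ G.Adj x (p i)) (hyk : G.Adj y (p k))
    (hyp : ∀ i < k, ¬ G.Adj y (p i)) :
    ∃ A : Set V, (G.induce A).IsCanonicalOfOrder k := by
  classical
  -- The body is `p 1, …, p k`; the left wings are `x` and `p 0`, the right wings `y` and `p (k +
  -- 1)`. Adjacency within either pair of wings is left free and fixes the two Booleans below.
  let f : Fin k ⊕ (Fin 2 ⊕ Fin 2) → V := Sum.elim (fun a => p (a + 1))
    (Sum.elim (fun a => if a = 0 then x else p 0) (fun a => if a = 0 then y else p (k + 1)))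
  have hp := fun i j (hi : i < k + 2) (hj : j < k + 2) => h.adj_iff hi hj
  have hpi := fun i j (hi : i < k + 2) (hj : j < k + 2) => h.injOn (i := i) (j := j) hi hj
  have x1 : ∀ a : Fin k, G.Adj x (p (a + 1)) ↔ a.1 = 0 := fun a =>
    ⟨fun hh => by_contra fun h0 => hxp _ (by omega) (by omega) hh, fun hh => by rwa [hh]⟩
  have x2 : ∀ a : Fin k, G.Adj (p (a + 1)) x ↔ a.1 = 0 := fun a => by rw [G.adj_comm, x1]
  have y1 : ∀ a : Fin k, G.Adj y (p (a + 1)) ↔ a.1 + 1 = k := fun a =>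
    ⟨fun hh => by_contra fun h0 => hyp _ (by omega) hh, fun hh => by rwa [hh]⟩
  have y2 : ∀ a : Fin k, G.Adj (p (a + 1)) y ↔ a.1 + 1 = k := fun a => by rw [G.adj_comm, y1]
  have x3 : ¬ G.Adj x (p (k + 1)) := hxp _ (by omega) (by omega)
  have x4 : ¬ G.Adj (p (k + 1)) x := fun hh => x3 hh.symm
  have y3 : ¬ G.Adj y (p 0) := hyp _ (by omega)
  have y4 : ¬ G.Adj (p 0) y := fun hh => y3 hh.symm
  have p1 : ∀ a : Fin k, G.Adj (p (a + 1)) (p 0) ↔ a.1 = 0 := fun a => by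
    rw [hp _ _ (by omega) (by omega)]; omega
  have p2 : ∀ a : Fin k, G.Adj (p 0) (p (a + 1)) ↔ a.1 = 0 := fun a => by rw [G.adj_comm, p1]
  have p3 : ∀ a : Fin k, G.Adj (p (a + 1)) (p (k + 1)) ↔ a.1 + 1 = k := fun a => by
    rw [hp _ _ (by omega) (by omega)]; omega
  have p4 : ∀ a : Fin k, G.Adj (p (k + 1)) (p (a + 1)) ↔ a.1 + 1 = k := fun a => by
    rw [G.adj_comm, p3]
  have p5 : ¬ G.Adj (p 0) (p (k + 1)) := by rw [hp _ _ (by omega) (by omega)]; omega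
  have p6 : ¬ G.Adj (p (k + 1)) (p 0) := fun hh => p5 hh.symm
  have hnyx : ¬ G.Adj y x := fun hh => hnxy hh.symm
  have q1 : ∀ a : Fin k, p (a + 1) ≠ p 0 := fun a hh => by
    have := hpi _ _ (by omega) (by omega) hh; omega
  have q2 : ∀ a : Fin k, p (a + 1) ≠ p (k + 1) := fun a hh => by
    have := hpi _ _ (by omega) (by omega) hh; omega
  have q3 : p 0 ≠ p (k + 1) := fun hh => by
    have := hpi _ _ (by omega) (by omega) hh; omega
  have r1 : ∀ a : Fin k, x ≠ p (a + 1) := fun a => hx _ (by omega)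
  have r2 : ∀ a : Fin k, y ≠ p (a + 1) := fun a => hy _ (by omega)
  have r3 := hx 0 (by omega)
  have r4 := hy 0 (by omega)
  have r5 := hx (k + 1) (by omega)
  have r6 := hy (k + 1) (by omega)
  have hinj : Function.Injective f := by
    rintro (a | a | a) (b | b | b) hab
    · have := hpi _ _ (by omega) (by omega) hab
      exact congrArg Sum.inl (Fin.ext (by omega))
    all_goals
      first
      | (fin_cases a <;> fin_cases b <;>
          simp [f, hxy, hxy.symm, q3, q3.symm, r3, r4, r5, r6, r3.symm, r4.symm, r5.symm,
            r6.symm] at hab ⊢)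
      | (fin_cases a <;> simp [f, (q1 _).symm, (q2 _).symm, r1, r2] at hab ⊢)
      | (fin_cases b <;> simp [f, q1, q2, (r1 _).symm, (r2 _).symm] at hab ⊢)
  let e : hGraph k (decide (G.Adj x (p 0))) (decide (G.Adj y (p (k + 1)))) ↪g G :=
    { toFun := f
      inj' := hinj
      map_rel_iff' := by
        rintro (a | a | a) (b | b | b)
        · simp only [f, hGraph, fromRel_adj, Function.Embedding.coeFn_mk, Sum.elim_inl]
          rw [hp _ _ (by omega) (by omega), ne_eq, Sum.inl.injEq, Fin.ext_iff]
          omega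
        all_goals
          first
          | (fin_cases a <;> fin_cases b <;>
              simp [f, hGraph, x3, x4, y3, y4, p5, p6, hnxy, hnyx, G.adj_comm (p 0) x,
                G.adj_comm (p (k + 1)) y])
          | (fin_cases a <;> simp [f, hGraph, x1, y1, p2, p4])
          | (fin_cases b <;> simp [f, hGraph, x2, y2, p1, p3]) }
  exact ⟨_, .hGraph k hk _ _ ⟨e.isoInduceRange.symm⟩⟩

end Canonical

/-! ### Gyárfás paths and dense vertices -/

section LongPaths

/-- `z` has a neighbour among any `σ` consecutive terms of `f` on `[a, b)`. -/
def IsDenseOn {V : Type u} (G : SimpleGraph V) (f : ℕ → V) (z : V) (σ a b : ℕ) : Prop :=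
  ∀ i, a ≤ i → i + σ ≤ b → ∃ j, i ≤ j ∧ j < i + σ ∧ G.Adj z (f j)

theorem IsDenseOn.mono {V : Type u} {G : SimpleGraph V} {f : ℕ → V} {z : V} {σ τ a b a' b' : ℕ}
    (h : IsDenseOn G f z σ a b) (hσ : σ ≤ τ) (ha : a ≤ a') (hb : b' ≤ b) :
    IsDenseOn G f z τ a' b' := by
  intro i hi hib
  obtain ⟨j, h1, h2, h3⟩ := h i (by omega) (by omega)
  exact ⟨j, h1, by omega, h3⟩

theorem reachable_inside_of_adj {V : Type u} {G : SimpleGraph V} {f : ℕ → V} {a b : ℕ} {C : Set V}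
    (hf : ∀ i, a ≤ i → i + 1 < b → G.Adj (f i) (f (i + 1)))
    (hC : ∀ i, a ≤ i → i < b → f i ∈ C) {i : ℕ} (hai : a ≤ i) (hib : i < b) :
    (inside G C).Reachable (f a) (f i) := by
  induction i, hai using Nat.le_induction with
  | base => exact Reachable.refl _
  | succ i hi ih =>
    exact (ih (by omega)).trans
      (Adj.reachable ⟨hf i hi (by omega), hC i hi (by omega), hC _ (by omega) hib⟩)

/-- The component of `C` containing `r` is connected. -/
theorem reachable_inside_component {V : Type u} {G : SimpleGraph V} {C : Set V} {r : V}
    {x y : V} (hx : (inside G C).Reachable r x ∧ x ∈ C) (hy : (inside G C).Reachable r y ∧ y ∈ C) :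
    (inside G {d | (inside G C).Reachable r d ∧ d ∈ C}).Reachable x y := by
  have main : ∀ d, (inside G C).Reachable r d →
      (inside G {d | (inside G C).Reachable r d ∧ d ∈ C}).Reachable r d := by
    intro d hd
    rw [reachable_iff_reflTransGen] at hd
    induction hd with
    | refl => exact Reachable.refl _
    | @tail b c hb hbc ih =>
      have hb' := (reachable_iff_reflTransGen _ _).2 hb
      exact ih.trans (Adj.reachable ⟨hbc.1, ⟨hb', hbc.2.1⟩, hb'.trans hbc.reachable, hbc.2.2⟩)
  exact (main x hx.1).symm.trans (main y hy.1)

/-- Gyárfás' path argument: a connected set containing a long path and adjacent to `x` contains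
either an induced path starting in `x`, or a vertex that is dense on a long subpath. -/
theorem exists_isIndPath_or_isDenseOn (n : ℕ) : ∀ g : ℕ → ℕ, ∃ N : ℕ,
    ∀ {V : Type u} (G : SimpleGraph V) (f : ℕ → V) (a b : ℕ),
    (∀ i, a ≤ i → i + 1 < b → G.Adj (f i) (f (i + 1))) → a + N ≤ b → ∀ (x : V) (C : Set V),
    x ∉ C → (∀ i, a ≤ i → i < b → f i ∈ C) → (∃ c ∈ C, G.Adj x c) →
    (∀ c ∈ C, ∀ d ∈ C, (inside G C).Reachable c d) →
    (∃ p, IsIndPath G p (n + 1) ∧ p 0 = x ∧ ∀ i, 0 < i → i < n + 1 → p i ∈ C) ∨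
    ∃ z ∈ insert x C, ∃ σ a' b', a ≤ a' ∧ b' ≤ b ∧ a' + g σ ≤ b' ∧
      (∀ i, a' ≤ i → i < b' → z ≠ f i) ∧ IsDenseOn G f z σ a' b' := by
  intro g
  induction n with
  | zero =>
    refine ⟨0, fun G f a b _ _ x C _ _ _ _ => Or.inl ⟨fun _ => x, ?_, rfl, ?_⟩⟩
    · intro i j hij hj
      omega
    · intro i hi hi'
      omega
  | succ n ih =>
    obtain ⟨N, hN⟩ := ih
    -- If `x` is not `(N + 1)`-dense on the whole path, some window of `N + 1` vertices misses its
    -- neighbourhood; the window is nonempty and long enough for the induction hypothesis.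
    refine ⟨max (N + 1) (g (N + 1)), fun {V} G f a b hf hab x C hxC hfC hxc hC => ?_⟩
    by_cases hdense : IsDenseOn G f x (N + 1) a b
    · exact Or.inr ⟨x, Set.mem_insert _ _, N + 1, a, b, le_rfl, le_rfl, by omega,
        fun i hi hib he => hxC (he ▸ hfC i hi hib), hdense⟩
    unfold IsDenseOn at hdense
    push Not at hdense
    obtain ⟨i, hai, hib, hi⟩ := hdense
    set C' : Set V := {c | c ∈ C ∧ ¬ G.Adj x c} with hC'
    set D : Set V := {d | (inside G C').Reachable (f i) d ∧ d ∈ C'} with hD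
    have hfC' : ∀ j, i ≤ j → j < i + (N + 1) → f j ∈ C' := fun j h1 h2 =>
      ⟨hfC j (by omega) (by omega), hi j h1 h2⟩
    have hfD : ∀ j, i ≤ j → j < i + (N + 1) → f j ∈ D := fun j h1 h2 =>
      ⟨reachable_inside_of_adj (fun k h3 h4 => hf k (by omega) (by omega)) hfC' h1 h2,
        hfC' j h1 h2⟩
    have hfi := hfD i le_rfl (by omega)
    -- `D` is the component of the window among the non-neighbours of `x`. A walk in `C` from `D` to
    -- a neighbour of `x` leaves `D` at a neighbour `y` of `x`. The search continues from `y` into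
    -- `D`, where nothing is adjacent to `x`, so prepending `x` keeps the path induced.
    have hy : ∃ y ∈ C, G.Adj x y ∧ ∃ d ∈ D, G.Adj y d := by
      obtain ⟨c, hc, hxc⟩ := hxc
      have hr := hC (f i) hfi.2.1 c hc
      rw [reachable_iff_reflTransGen] at hr
      have main : ∀ c, Relation.ReflTransGen (inside G C).Adj (f i) c →
          c ∈ D ∨ ∃ y ∈ C, G.Adj x y ∧ ∃ d ∈ D, G.Adj y d := by
        intro c hr
        induction hr with
        | refl => exact Or.inl hfi
        | @tail b c _ hbc ih =>
          rcases ih with hb | ih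
          · by_cases hxc : G.Adj x c
            · exact Or.inr ⟨c, hbc.2.2, hxc, b, hb, hbc.1.symm⟩
            · have hc' : c ∈ C' := ⟨hbc.2.2, hxc⟩
              exact Or.inl ⟨hb.1.trans (Adj.reachable ⟨hbc.1, hb.2, hc'⟩), hc'⟩
          · exact Or.inr ih
      rcases main c hr with h1 | h1
      · exact absurd hxc h1.2.2
      · exact h1
    obtain ⟨y, hyC, hxy, d, hdD, hyd⟩ := hy
    have hDC : D ⊆ C := fun d hd => hd.2.1
    rcases hN G f i (i + (N + 1)) (fun k h3 h4 => hf k (by omega) (by omega)) (by omega) y D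
      (fun hyD => hyD.2.2 hxy) hfD ⟨d, hdD, hyd⟩
      (fun c hc d hd => reachable_inside_component hc hd) with
      ⟨p, hp, hp0, hpD⟩ | ⟨z, hz, σ, a', b', h1, h2, h3⟩
    · refine Or.inl ⟨_, hp.cons (x := x) ?_ ?_, rfl, ?_⟩
      · intro j hj he
        apply hxC
        rcases Nat.eq_zero_or_pos j with rfl | hj0
        · rw [he, hp0]; exact hyC
        · rw [he]; exact hDC (hpD j hj0 hj)
      · intro j hj
        rcases Nat.eq_zero_or_pos j with rfl | hj0
        · simp [hp0, hxy]
        · exact iff_of_false (hpD j hj0 hj).2.2 (by omega)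
      · intro j hj0 hj
        obtain ⟨j, rfl⟩ : ∃ k, j = k + 1 := ⟨j - 1, by omega⟩
        rcases Nat.eq_zero_or_pos j with rfl | hj0
        · show p 0 ∈ C
          rw [hp0]; exact hyC
        · exact hDC (hpD j hj0 (by omega))
    · refine Or.inr ⟨z, ?_, σ, a', b', by omega, by omega, h3⟩
      rcases hz with rfl | hz
      · exact Or.inr hyC
      · exact Or.inr (hDC hz)

/-- A long path contains an induced path on `n` vertices, or many vertices that are dense on a
common long subpath. -/
theorem exists_isIndPath_or_finset_isDenseOn (n c : ℕ) : ∀ g : ℕ → ℕ, ∃ N : ℕ,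
    ∀ {V : Type u} (G : SimpleGraph V) (f : ℕ → V) (a b : ℕ),
    (∀ i, a ≤ i → i + 1 < b → G.Adj (f i) (f (i + 1))) → Set.InjOn f (Set.Ico a b) → a + N ≤ b →
    (∃ p, IsIndPath G p n ∧ ∀ i < n, p i ∈ f '' Set.Ico a b) ∨
    ∃ (Z : Finset V) (σ a' b' : ℕ), a ≤ a' ∧ b' ≤ b ∧ a' + g σ ≤ b' ∧ Z.card = c ∧
      ∀ z ∈ Z, z ∈ f '' Set.Ico a b ∧ z ∉ f '' Set.Ico a' b' ∧ IsDenseOn G f z σ a' b' := by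
  classical
  induction c with
  | zero =>
    exact fun g => ⟨g 0, fun G f a b _ _ hab => Or.inr ⟨∅, 0, a, b, le_rfl, le_rfl, hab, rfl,
      by simp⟩⟩
  | succ c ih =>
    intro g
    choose N1 hN1 using exists_isIndPath_or_isDenseOn.{u} n
    -- The subpath kept for the first `c` vertices must be long enough for another round of Gyárfás'
    -- argument. The length demanded there anticipates the combined density `max σ τ`, and the extra
    -- `2` leaves room for a starting vertex `f a'` and a successor.
    obtain ⟨N, hN⟩ := ih fun σ => N1 (fun τ => g (max σ τ)) + 2
    refine ⟨N, fun {V} G f a b hf hinj hab => ?_⟩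
    rcases hN G f a b hf hinj hab with h | ⟨Z, σ, a', b', ha, hb, hab', hZ, hZd⟩
    · exact Or.inl h
    have hmem : ∀ i, a' ≤ i → i < b' → f i ∈ f '' Set.Ico a b := fun i h1 h2 =>
      ⟨i, ⟨by omega, by omega⟩, rfl⟩
    have hCsub : ∀ y ∈ f '' Set.Ico (a' + 1) b', y ∈ f '' Set.Ico a b := by
      rintro _ ⟨i, hi, rfl⟩
      exact hmem i (by have := hi.1; omega) hi.2
    have hfa : f a' ∉ f '' Set.Ico (a' + 1) b' := by
      rintro ⟨j, hj, hji⟩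
      have := hinj ⟨by have := hj.1; omega, hj.2.trans_le hb⟩ ⟨ha, by omega⟩ hji
      have := hj.1
      omega
    have hconn : ∀ c ∈ f '' Set.Ico (a' + 1) b', ∀ d ∈ f '' Set.Ico (a' + 1) b',
        (inside G (f '' Set.Ico (a' + 1) b')).Reachable c d := by
      have hr : ∀ i ∈ Set.Ico (a' + 1) b',
          (inside G (f '' Set.Ico (a' + 1) b')).Reachable (f (a' + 1)) (f i) := fun i hi =>
        reachable_inside_of_adj (b := b') (C := f '' Set.Ico (a' + 1) b')
          (fun i h1 h2 => hf i (by omega) (by omega))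
          (fun i h1 h2 => ⟨i, ⟨h1, h2⟩, rfl⟩) hi.1 hi.2
      rintro _ ⟨i, hi, rfl⟩ _ ⟨j, hj, rfl⟩
      exact (hr i hi).symm.trans (hr j hj)
    rcases hN1 (fun τ => g (max σ τ)) G f (a' + 1) b' (fun i h1 h2 => hf i (by omega) (by omega))
      (by omega) (f a') (f '' Set.Ico (a' + 1) b') hfa (fun i h1 h2 => ⟨i, ⟨h1, h2⟩, rfl⟩)
      ⟨f (a' + 1), Set.mem_image_of_mem f (Set.left_mem_Ico.2 (by omega)), hf a' ha (by omega)⟩ hconn with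
      ⟨p, hp, hp0, hpC⟩ | ⟨z, hz, τ, a'', b'', h1, h2, h3, h4, h5⟩
    · refine Or.inl ⟨p, hp.mono (by omega), fun i hi => ?_⟩
      rcases Nat.eq_zero_or_pos i with rfl | hi0
      · rw [hp0]
        exact hmem a' le_rfl (by omega)
      · exact hCsub _ (hpC i hi0 (by omega))
    · have hz' : ∃ i, a' ≤ i ∧ i < b' ∧ f i = z := by
        rcases hz with rfl | ⟨i, hi, rfl⟩
        · exact ⟨a', le_rfl, by omega, rfl⟩
        · exact ⟨i, by have := hi.1; omega, hi.2, rfl⟩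
      obtain ⟨i, hi1, hi2, rfl⟩ := hz'
      have hzZ : f i ∉ Z := fun hz => (hZd _ hz).2.1 ⟨i, ⟨hi1, hi2⟩, rfl⟩
      refine Or.inr ⟨insert (f i) Z, max σ τ, a'', b'', by omega, by omega, h3, by
        rw [Finset.card_insert_of_notMem hzZ, hZ], fun z hz => ?_⟩
      rcases Finset.mem_insert.1 hz with rfl | hz
      · refine ⟨hmem i hi1 hi2, ?_, h5.mono (le_max_right _ _) le_rfl le_rfl⟩
        rintro ⟨j, hj, hji⟩
        exact h4 j hj.1 hj.2 hji.symm
      · obtain ⟨k1, k2, k3⟩ := hZd z hz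
        refine ⟨k1, ?_, k3.mono (le_max_left _ _) (by omega) h2⟩
        rintro ⟨j, hj, hji⟩
        exact k2 ⟨j, ⟨by have := hj.1; omega, hj.2.trans_le h2⟩, hji⟩

end LongPaths

/-! ### Ramsey-type selection -/

section Ramsey

/-- Ramsey's theorem for graphs. -/
theorem exists_homogeneous_finset (a b : ℕ) : ∃ N : ℕ, ∀ {ι : Type u} (r : ι → ι → Prop),
    (∀ x y, r x y → r y x) → ∀ S : Finset ι, N ≤ S.card →
    (∃ T ⊆ S, T.card = a ∧ ∀ x ∈ T, ∀ y ∈ T, x ≠ y → r x y) ∨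
    ∃ T ⊆ S, T.card = b ∧ ∀ x ∈ T, ∀ y ∈ T, x ≠ y → ¬ r x y := by
  classical
  induction a generalizing b with
  | zero => exact ⟨0, fun r _ S _ => Or.inl ⟨∅, by simp⟩⟩
  | succ a iha =>
    induction b with
    | zero => exact ⟨0, fun r _ S _ => Or.inr ⟨∅, by simp⟩⟩
    | succ b ihb =>
      obtain ⟨N1, h1⟩ := iha (b + 1)
      obtain ⟨N2, h2⟩ := ihb
      refine ⟨N1 + N2 + 1, fun {ι} r hr S hS => ?_⟩
      obtain ⟨x, hx⟩ := Finset.card_pos.1 (by omega : 0 < S.card)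
      have hsum := Finset.card_filter_add_card_filter_not (s := S.erase x) (r x)
      rw [Finset.card_erase_of_mem hx] at hsum
      by_cases hN : N1 ≤ ((S.erase x).filter (r x)).card
      · rcases h1 r hr _ hN with ⟨T, hTS, hT, hTr⟩ | ⟨T, hTS, hT, hTr⟩
        · have hxT : x ∉ T := fun h => by simpa using hTS h
          refine Or.inl ⟨insert x T, ?_, by rw [Finset.card_insert_of_notMem hxT, hT], ?_⟩
          · exact Finset.insert_subset hx
              (hTS.trans ((Finset.filter_subset _ _).trans (Finset.erase_subset _ _)))
          · have hxr : ∀ y ∈ T, r x y := fun y hy => (Finset.mem_filter.1 (hTS hy)).2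
            intro y hy z hz hyz
            rcases Finset.mem_insert.1 hy with rfl | hy'
            · exact hxr z ((Finset.mem_insert.1 hz).resolve_left hyz.symm)
            · rcases Finset.mem_insert.1 hz with rfl | hz
              · exact hr _ _ (hxr y hy')
              · exact hTr y hy' z hz hyz
        · exact Or.inr ⟨T, hTS.trans ((Finset.filter_subset _ _).trans (Finset.erase_subset _ _)),
            hT, hTr⟩
      · rcases h2 r hr ((S.erase x).filter fun y => ¬ r x y) (by omega) with
          ⟨T, hTS, hT, hTr⟩ | ⟨T, hTS, hT, hTr⟩
        · exact Or.inl ⟨T, hTS.trans ((Finset.filter_subset _ _).trans (Finset.erase_subset _ _)),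
            hT, hTr⟩
        · have hxT : x ∉ T := fun h => by simpa using hTS h
          refine Or.inr ⟨insert x T, ?_, by rw [Finset.card_insert_of_notMem hxT, hT], ?_⟩
          · exact Finset.insert_subset hx
              (hTS.trans ((Finset.filter_subset _ _).trans (Finset.erase_subset _ _)))
          · have hxr : ∀ y ∈ T, ¬ r x y := fun y hy => (Finset.mem_filter.1 (hTS hy)).2
            intro y hy z hz hyz
            rcases Finset.mem_insert.1 hy with rfl | hy'
            · exact hxr z ((Finset.mem_insert.1 hz).resolve_left hyz.symm)
            · rcases Finset.mem_insert.1 hz with rfl | hz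
              · exact fun h => hxr y hy' (hr _ _ h)
              · exact hTr y hy' z hz hyz

/-- Among many disjoint small sets there are `m` that are pairwise anticomplete, unless there is a
complete bipartite subgraph. -/
theorem exists_anticomplete_finset {q n : ℕ} (hq : 0 < q) (hn : 0 < n) (m : ℕ) :
    ∃ N : ℕ, ∀ {V : Type u} {ι : Type v} (G : SimpleGraph V) (S : Finset ι) (U : ι → Finset V),
    (∀ i ∈ S, ∀ j ∈ S, ∀ x ∈ U i, x ∈ U j → i = j) → (∀ i ∈ S, (U i).card ≤ n) →
    N ≤ S.card → IsContained (completeBipartiteGraph (Fin q) (Fin q)) G ∨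
    ∃ T ⊆ S, T.card = m ∧ ∀ i ∈ T, ∀ j ∈ T, i ≠ j → ∀ x ∈ U i, ∀ y ∈ U j, ¬ G.Adj x y := by
  classical
  -- A pairwise touching family of this size splits into two parts just large enough to force
  -- `K_{q,q}`.
  obtain ⟨N, hN⟩ := exists_homogeneous_finset.{v}
    (q * n + q * (n ^ (q * n) * 2 ^ (q * n))) m
  refine ⟨N, fun {V ι} G S U hU hUn hS => ?_⟩
  rcases hN (fun i j => ∃ x ∈ U i, ∃ y ∈ U j, G.Adj x y)
    (fun i j ⟨x, hx, y, hy, h⟩ => ⟨y, hy, x, hx, h.symm⟩) S hS with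
    ⟨T, hTS, hT, hTr⟩ | ⟨T, hTS, hT, hTr⟩
  · left
    obtain ⟨I, hIT, hI⟩ := Finset.exists_subset_card_eq (s := T) (n := q * n) (by omega)
    have hJ : (T \ I).card = q * (n ^ (q * n) * 2 ^ (q * n)) := by
      rw [Finset.card_sdiff_of_subset hIT]; omega
    have hJT : T \ I ⊆ T := Finset.sdiff_subset
    refine isContained_completeBipartiteGraph_of_families hq hn (I := I) (J := T \ I) (A := U)
      (B := U) (fun i hi j hj => hU i (hTS (hIT hi)) j (hTS (hIT hj)))
      (fun i hi j hj => hU i (hTS (hJT hi)) j (hTS (hJT hj)))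
      (fun i hi => hUn i (hTS (hIT hi))) (fun i hi => hUn i (hTS (hJT hi))) hI.ge
      (by rw [hI, hJ]) ?_
    intro i hi j hj
    exact hTr i (hIT hi) j (hJT hj) fun h => (Finset.mem_sdiff.1 hj).2 (h ▸ hi)
  · right
    exact ⟨T, hTS, hT, fun i hi j hj hij x hx y hy hxy => hTr i hi j hj hij ⟨x, hx, y, hy, hxy⟩⟩

/-- A large set contains a long sequence that avoids the bounded sets `B a b` assigned to pairs of
consecutive members. -/
theorem exists_seq_notMem (m β : ℕ) : ∃ c : ℕ, ∀ {V : Type u} (B : V → V → Finset V),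
    (∀ a b, (B a b).card ≤ β) → ∀ (Z : Finset V) (z : V), c ≤ Z.card →
    ∃ h : ℕ → V, h 0 = z ∧ (∀ i, 0 < i → i ≤ m → h i ∈ Z) ∧
      (∀ i j, 0 < i → i < j → j ≤ m → h i ≠ h j) ∧
      ∀ i j, 0 < i → i ≤ m → j + 1 ≤ m → i ≠ j → i ≠ j + 1 → h i ∉ B (h j) (h (j + 1)) := by
  classical
  induction m with
  | zero => exact ⟨0, fun B _ Z z _ => ⟨fun _ => z, rfl, by omega, by omega, by omega⟩⟩
  | succ m ih =>
    obtain ⟨c, hc⟩ := ih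
    -- Reserve `Y` of size `c + β` for later terms and choose the next term `y` outside `Y` and
    -- outside every `B a b` with `a`, `b` in `Y`. Continuing from `y` within `Y \ B z y`, which
    -- still has `c` elements, makes later terms avoid the pair just formed.
    refine ⟨(c + β) + (c + β) * ((c + β) * β) + 1, fun {V} B hB Z z hZ => ?_⟩
    obtain ⟨Y, hYZ, hY⟩ := Finset.exists_subset_card_eq (s := Z) (n := c + β) (by omega)
    have hX : (Y ∪ Y.biUnion fun a => Y.biUnion fun b => B a b).card < Z.card := by
      refine lt_of_le_of_lt (Finset.card_union_le _ _) ?_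
      have h1 : ∀ a ∈ Y, (Y.biUnion fun b => B a b).card ≤ (c + β) * β := fun a _ => by
        rw [← hY]
        exact Finset.card_biUnion_le_card_mul _ _ _ fun b _ => hB a b
      have h2 := Finset.card_biUnion_le_card_mul Y _ _ h1
      rw [hY] at h2
      omega
    obtain ⟨y, hyZ, hy⟩ := Finset.exists_mem_notMem_of_card_lt_card hX
    rw [Finset.mem_union, not_or] at hy
    have hyB : ∀ a ∈ Y, ∀ b ∈ Y, y ∉ B a b := fun a ha b hb hyb =>
      hy.2 (Finset.mem_biUnion.2 ⟨a, ha, Finset.mem_biUnion.2 ⟨b, hb, hyb⟩⟩)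
    have hYB : c ≤ (Y \ B z y).card := by
      have h1 := Finset.le_card_sdiff (B z y) Y
      have h2 := hB z y
      omega
    obtain ⟨h, h0, hhZ, hinj, hhB⟩ := hc B hB (Y \ B z y) y hYB
    have hhY : ∀ i, 0 < i → i ≤ m → h i ∈ Y := fun i hi him =>
      (Finset.mem_sdiff.1 (hhZ i hi him)).1
    refine ⟨fun i => Nat.casesOn i z h, rfl, ?_, ?_, ?_⟩
    · intro i hi him
      obtain ⟨i, rfl⟩ : ∃ k, i = k + 1 := ⟨i - 1, by omega⟩
      rcases Nat.eq_zero_or_pos i with rfl | hi0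
      · show h 0 ∈ Z
        rwa [h0]
      · exact hYZ (hhY i hi0 (by omega))
    · intro i j hi hij hj
      obtain ⟨i, rfl⟩ : ∃ k, i = k + 1 := ⟨i - 1, by omega⟩
      obtain ⟨j, rfl⟩ : ∃ k, j = k + 1 := ⟨j - 1, by omega⟩
      rcases Nat.eq_zero_or_pos i with rfl | hi0
      · show h 0 ≠ h j
        rw [h0]
        intro he
        exact hy.1 (he ▸ hhY j (by omega) (by omega))
      · exact hinj i j hi0 (by omega) (by omega)
    · intro i j hi him hj hij hij'
      obtain ⟨i, rfl⟩ : ∃ k, i = k + 1 := ⟨i - 1, by omega⟩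
      cases j with
      | zero =>
        show h i ∉ B z (h 0)
        rw [h0]
        exact (Finset.mem_sdiff.1 (hhZ i (by omega) (by omega))).2
      | succ j =>
        show h i ∉ B (h j) (h (j + 1))
        rcases Nat.eq_zero_or_pos i with rfl | hi0
        · rw [h0]
          exact hyB _ (hhY j (by omega) (by omega)) _ (hhY (j + 1) (by omega) (by omega))
        · exact hhB i j hi0 (by omega) (by omega) (by omega) (by omega)

end Ramsey

/-! ### From long paths to long induced paths -/

section LongInducedPaths

variable {V : Type u} {G : SimpleGraph V}

/-- Independent vertices joined in a row by pairwise anticomplete connecting sets, each of which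
avoids the neighbours of the other vertices, yield a long induced path. -/
theorem exists_isIndPath_of_hubs {n : ℕ} {H : ℕ → V} {P : ℕ → Set V}
    (hinj : ∀ i j, i < j → j < n + 2 → H i ≠ H j)
    (hind : ∀ i < n + 2, ∀ j < n + 2, ¬ G.Adj (H i) (H j))
    (hreach : ∀ j < n + 1, (inside G (P j ∪ {H j, H (j + 1)})).Reachable (H j) (H (j + 1)))
    (hHP : ∀ i < n + 2, ∀ j < n + 1, i ≠ j → i ≠ j + 1 → ∀ x ∈ P j, ¬ G.Adj (H i) x)
    (hPP : ∀ i < n + 1, ∀ j < n + 1, i ≠ j → ∀ x ∈ P i, ∀ y ∈ P j, ¬ G.Adj x y) :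
    ∃ p, IsIndPath G p (n + 2) ∧
      ∀ i < n + 2, (∃ j < n + 2, p i = H j) ∨ ∃ j < n + 1, p i ∈ P j := by
  set S : Set V := {x | (∃ j < n + 2, x = H j) ∨ ∃ j < n + 1, x ∈ P j} with hS
  have hr : ∀ k ≤ n + 1, (inside G S).Reachable (H 0) (H k) := by
    intro k
    induction k with
    | zero => exact fun _ => Reachable.refl _
    | succ k ih =>
      intro hk
      refine (ih (by omega)).trans ((hreach k (by omega)).mono (inside_mono ?_))
      rintro x (hx | rfl | rfl)
      · exact Or.inr ⟨k, by omega, hx⟩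
      · exact Or.inl ⟨k, by omega, rfl⟩
      · exact Or.inl ⟨k + 1, by omega, rfl⟩
  obtain ⟨p, m, hp, hp0, hpm, hpS⟩ := exists_isIndPath_of_reachable_inside
    (U := S) (x := H 0) (Or.inl ⟨0, by omega, rfl⟩) (hr (n + 1) le_rfl)
  -- Label the hub `H j` by `2 * j` and the vertices of `P j` by `2 * j + 1`. An edge raises the
  -- label by at most one, so a geodesic from `H 0` to `H (n + 1)` is long.
  let lab : V → ℕ → Prop := fun x l =>
    (∃ j < n + 2, l = 2 * j ∧ x = H j) ∨ ∃ j < n + 1, l = 2 * j + 1 ∧ x ∈ P j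
  have hlab : ∀ x ∈ S, ∃ l, lab x l := by
    rintro x (⟨j, hj, rfl⟩ | ⟨j, hj, hx⟩)
    · exact ⟨_, Or.inl ⟨j, hj, rfl, rfl⟩⟩
    · exact ⟨_, Or.inr ⟨j, hj, rfl, hx⟩⟩
  have hstep : ∀ x y l l', G.Adj x y → lab x l → lab y l' → l' ≤ l + 1 := by
    rintro x y l l' hxy (⟨i, hi, rfl, rfl⟩ | ⟨i, hi, rfl, hx⟩) (⟨j, hj, rfl, rfl⟩ | ⟨j, hj, rfl, hy⟩)
    · exact absurd hxy (hind i hi j hj)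
    · by_contra hlt
      exact hHP i hi j hj (by omega) (by omega) y hy hxy
    · by_contra hlt
      exact hHP j hj i hi (by omega) (by omega) x hx hxy.symm
    · by_contra hlt
      exact hPP i hi j hj (by omega) x hx y hy hxy
  have hall : ∀ i ≤ m, ∃ l ≤ i, lab (p i) l := by
    intro i
    induction i with
    | zero => exact fun _ => ⟨0, le_rfl, Or.inl ⟨0, by omega, rfl, hp0⟩⟩
    | succ i ih =>
      intro hi
      obtain ⟨l, hl, hpl⟩ := ih (by omega)
      obtain ⟨l', hl'⟩ := hlab _ (hpS (i + 1) hi)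
      have hadj := (hp i (i + 1) (by omega) (by omega)).2.2 rfl
      exact ⟨l', (hstep _ _ _ _ hadj hpl hl').trans (by omega), hl'⟩
  have hm : 0 < m := by
    rcases Nat.eq_zero_or_pos m with rfl | hm
    · exact absurd (hp0.symm.trans hpm) (hinj 0 (n + 1) (by omega) (by omega))
    · exact hm
  have hm1 : m - 1 < m := Nat.sub_lt hm one_pos
  obtain ⟨l, hl, hpl⟩ := hall (m - 1) hm1.le
  have hadj := (hp (m - 1) m hm1 (Nat.lt_succ_self m)).2.2 (Nat.succ_pred_eq_of_pos hm).symm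
  have hlast := hstep _ _ _ _ hadj hpl (Or.inl ⟨n + 1, by omega, rfl, hpm⟩)
  have hnm : n + 2 ≤ m + 1 := by omega
  exact ⟨p, hp.mono hnm, fun i hi => hpS i (by omega)⟩

/-- In a graph without a complete bipartite subgraph `K_{q,q}`, the vertex set of a long path
contains a long induced path. -/
theorem exists_isIndPath_of_path (n : ℕ) {q : ℕ} (hq : 0 < q) : ∃ N : ℕ,
    ∀ {V : Type u} (G : SimpleGraph V) (f : ℕ → V) (a b : ℕ),
    (∀ i, a ≤ i → i + 1 < b → G.Adj (f i) (f (i + 1))) → Set.InjOn f (Set.Ico a b) → a + N ≤ b →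
    ¬ IsContained (completeBipartiteGraph (Fin q) (Fin q)) G →
    ∃ p, IsIndPath G p n ∧ ∀ i < n, p i ∈ f '' Set.Ico a b := by
  classical
  set n' := n + 2 with hn'
  set β := q * n' with hβ
  obtain ⟨c0, hc0⟩ := exists_seq_notMem.{u} n' β
  obtain ⟨c, hc⟩ := exists_anticomplete_finset.{u, u} hq one_pos (c0 + 1)
  obtain ⟨K2, hK2⟩ := exists_anticomplete_finset.{u, 0} hq
    (show 0 < n' * n' by positivity) n'
  set K' := max (q * (n' ^ β * 2 ^ β)) (max K2 1) with hK'
  -- The factor in front of `K'` counts the maps from pairs of the `c0 + 1` candidate hubs to sets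
  -- of candidate hubs; `K'` windows will share one such map.
  set K := (2 ^ (c0 + 1)) ^ ((c0 + 1) * (c0 + 1)) * K' with hK
  obtain ⟨N, hN⟩ := exists_isIndPath_or_finset_isDenseOn.{u} n' c fun σ => K * σ
  refine ⟨N, fun {V} G f a b hf hinj hab hG => ?_⟩
  rcases hN G f a b hf hinj hab with
    ⟨p, hp, hpf⟩ | ⟨Z₀, σ, a', b', ha, hb, hab', hZ₀, hZ₀d⟩
  · exact ⟨p, hp.mono (by omega), fun i hi => hpf i (by omega)⟩
  by_contra hno
  have hno' : ∀ p m, n' ≤ m → IsIndPath G p m → ¬ ∀ i < m, p i ∈ f '' Set.Ico a b :=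
    fun p m hm hp hpf => hno ⟨p, hp.mono (by omega), fun i hi => hpf i (by omega)⟩
  obtain ⟨Z, hZZ, hZ, hZind⟩ := (hc G Z₀ (fun z => {z}) (by simp) (by simp)
    hZ₀.ge).resolve_left hG
  have hZd := fun z hz => hZ₀d z (hZZ hz)
  have hind : ∀ x ∈ Z, ∀ y ∈ Z, ¬ G.Adj x y := fun x hx y hy hxy =>
    hZind x hx y hy hxy.ne x (by simp) y (by simp) hxy
  -- Disjoint windows of `σ` consecutive path vertices; by density each vertex of `Z` has a
  -- neighbour in each of them.
  let W : ℕ → Set V := fun t => f '' Set.Ico (a' + t * σ) (a' + (t + 1) * σ)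
  have hWb : ∀ t < K, a' + (t + 1) * σ ≤ b' := fun t ht =>
    (Nat.add_le_add_left (Nat.mul_le_mul_right σ ht) a').trans hab'
  have hWf : ∀ t < K, W t ⊆ f '' Set.Ico a' b' := fun t ht =>
    Set.image_mono (Set.Ico_subset_Ico (Nat.le_add_right _ _) (hWb t ht))
  have hff : f '' Set.Ico a' b' ⊆ f '' Set.Ico a b := Set.image_mono (Set.Ico_subset_Ico ha hb)
  have hWdisj : ∀ t < K, ∀ t' < K, ∀ x ∈ W t, x ∈ W t' → t = t' := by
    have key : ∀ t < K, ∀ t' < K, ∀ x ∈ W t, x ∈ W t' → ¬ t < t' := by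
      rintro t ht t' ht' _ ⟨i, hi, rfl⟩ ⟨j, hj, hji⟩ htt
      have h1 := hWb t ht
      have h2 := hWb t' ht'
      have hij : j = i := hinj ⟨by have := hj.1; omega, by have := hj.2; omega⟩
        ⟨by have := hi.1; omega, by have := hi.2; omega⟩ hji
      have h3 : (t + 1) * σ ≤ t' * σ := Nat.mul_le_mul_right σ htt
      have := hi.2
      have := hj.1
      omega
    intro t ht t' ht' x hx hx'
    have := key t ht t' ht' x hx hx'
    have := key t' ht' t ht x hx' hx
    omega
  -- The connecting set is the interior of a geodesic from `z` to `z'` through window `t`. It is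
  -- small because long induced paths are assumed absent.
  have hP : ∀ z z' t, ∃ P : Finset V, z ∈ Z → z' ∈ Z → t < K → (P : Set V) ⊆ W t ∧ P.card ≤ n' ∧
      (inside G ((P : Set V) ∪ {z, z'})).Reachable z z' := by
    intro z z' t
    by_cases hcond : z ∈ Z ∧ z' ∈ Z ∧ t < K
    swap
    · exact ⟨∅, fun h1 h2 h3 => absurd ⟨h1, h2, h3⟩ hcond⟩
    obtain ⟨hz, hz', ht⟩ := hcond
    have hnb : ∀ z ∈ Z, ∃ j, a' + t * σ ≤ j ∧ j < a' + (t + 1) * σ ∧ G.Adj z (f j) := by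
      intro z hz
      have := hWb t ht
      rw [add_one_mul, ← add_assoc] at this ⊢
      exact (hZd z hz).2.2 _ (by omega) this
    obtain ⟨j, hj1, hj2, hzj⟩ := hnb z hz
    obtain ⟨j', hj1', hj2', hzj'⟩ := hnb z' hz'
    set S : Set V := W t ∪ {z, z'} with hS
    have hWS : ∀ i, a' + t * σ ≤ i → i < a' + (t + 1) * σ → f i ∈ S := fun i h1 h2 =>
      Or.inl ⟨i, ⟨h1, h2⟩, rfl⟩
    have hreach : (inside G S).Reachable z z' := by
      have h1 : ∀ i, a' + t * σ ≤ i → i < a' + (t + 1) * σ →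
          (inside G S).Reachable (f (a' + t * σ)) (f i) := fun i h1 h2 =>
        reachable_inside_of_adj (fun k h3 h4 => hf k (by omega) (by have := hWb t ht; omega))
          hWS h1 h2
      have h2 : (inside G S).Adj z (f j) := ⟨hzj, by simp [hS], hWS j hj1 hj2⟩
      have h3 : (inside G S).Adj z' (f j') := ⟨hzj', by simp [hS], hWS j' hj1' hj2'⟩
      exact h2.reachable.trans ((h1 j hj1 hj2).symm.trans ((h1 j' hj1' hj2').trans
        h3.symm.reachable))
    obtain ⟨p, m, hp, hp0, hpm, hpS⟩ := exists_isIndPath_of_reachable_inside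
      (by simp [hS]) hreach
    have hm : m + 1 < n' := by
      by_contra hm
      refine hno' p (m + 1) (by omega) hp fun i hi => ?_
      rcases hpS i (by omega) with h | h | h
      · exact hff (hWf t ht h)
      · rw [h]; exact (hZd z hz).1
      · rw [h]; exact (hZd z' hz').1
    refine ⟨((Finset.range (m + 1)).image p).filter fun x => x ≠ z ∧ x ≠ z', fun _ _ _ =>
      ⟨?_, ?_, ?_⟩⟩
    · intro x hx
      simp only [Finset.coe_filter, Finset.mem_image, Finset.mem_range, Set.mem_ofPred_eq] at hx
      obtain ⟨⟨i, hi, rfl⟩, hx⟩ := hx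
      rcases hpS i (by omega) with h | h | h
      · exact h
      · exact absurd h hx.1
      · exact absurd h hx.2
    · refine (Finset.card_filter_le _ _).trans (Finset.card_image_le.trans ?_)
      rw [Finset.card_range]
      omega
    · have := reachable_inside_of_adj (G := G) (f := p) (a := 0) (b := m + 1) (C :=
        ((((Finset.range (m + 1)).image p).filter fun x => x ≠ z ∧ x ≠ z' : Finset V) : Set V) ∪
          {z, z'})
        (fun i _ hi => (hp i (i + 1) (by omega) (by omega)).2.2 rfl) (fun i _ hi => by
          by_cases h1 : p i = z
          · right; simp [h1]
          by_cases h2 : p i = z'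
          · right; simp [h2]
          left
          simp only [Finset.coe_filter, Finset.mem_image, Finset.mem_range, Set.mem_ofPred_eq]
          exact ⟨⟨i, hi, rfl⟩, h1, h2⟩) (Nat.zero_le m) (by omega)
      rwa [hp0, hpm] at this
  choose P hP using hP
  let touch : V → V → ℕ → Finset V := fun z z' t =>
    Z.filter fun y => y ≠ z ∧ y ≠ z' ∧ ∃ x ∈ P z z' t, G.Adj y x
  -- Keep `K'` windows on which, for every pair of hubs, the same other hubs touch the connecting
  -- set.
  obtain ⟨pat, -, hpat⟩ := Finset.exists_le_card_fiber_of_mul_le_card_of_maps_to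
    (s := Finset.range K) (t := Fintype.piFinset fun _ : Z × Z => Z.powerset) (n := K')
    (f := fun t zz => touch zz.1 zz.2 t)
    (fun t _ => by
      simp only [Fintype.mem_piFinset, Finset.mem_powerset]
      exact fun _ => Finset.filter_subset _ _)
    ⟨fun _ => ∅, by simp⟩ (by
      rw [Fintype.card_piFinset, Finset.prod_const, Finset.card_range, Finset.card_powerset,
        Finset.card_univ, Fintype.card_prod, Fintype.card_coe, hZ])
  set J := (Finset.range K).filter fun t => (fun zz : Z × Z => touch zz.1 zz.2 t) = pat with hJ
  have hJK : ∀ t ∈ J, t < K := fun t ht => Finset.mem_range.1 (Finset.mem_filter.1 ht).1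
  have hpatJ : ∀ t ∈ J, ∀ (z z' : Z), touch z z' t = pat (z, z') := fun t ht z z' =>
    congrFun (Finset.mem_filter.1 ht).2 (z, z')
  let B : V → V → Finset V := fun z z' =>
    if h : z ∈ Z ∧ z' ∈ Z then pat (⟨z, h.1⟩, ⟨z', h.2⟩) else ∅
  have hBt : ∀ t ∈ J, ∀ z ∈ Z, ∀ z' ∈ Z, B z z' = touch z z' t := fun t ht z hz z' hz' => by
    simp only [B, hz, hz', and_self, dite_true]
    exact (hpatJ t ht ⟨z, hz⟩ ⟨z', hz'⟩).symm
  -- More than `β` hubs touching the connecting sets of one pair in all windows of `J` would give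
  -- `K_{q,q}`, as those sets are disjoint and small.
  have hBβ : ∀ z z', (B z z').card ≤ β := by
    intro z z'
    by_cases hcond : z ∈ Z ∧ z' ∈ Z
    swap
    · simp [B, hcond]
    by_contra hlt
    obtain ⟨I, hIB, hI⟩ := Finset.exists_subset_card_eq (s := B z z') (n := β) (by omega)
    refine hG (isContained_completeBipartiteGraph_of_families hq (n := n') (by omega) (I := I)
      (J := J) (A := fun y => {y}) (B := P z z') (by simp) ?_ ?_ ?_ hI.ge ?_ ?_)
    · intro t ht t' ht' x hx hx'
      exact hWdisj t (hJK t ht) t' (hJK t' ht') x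
        ((hP z z' t hcond.1 hcond.2 (hJK t ht)).1 hx)
        ((hP z z' t' hcond.1 hcond.2 (hJK t' ht')).1 hx')
    · intro i _
      simp [hn']
    · exact fun t ht => (hP z z' t hcond.1 hcond.2 (hJK t ht)).2.1
    · rw [hI]
      exact (le_max_left _ _).trans hpat
    · intro y hy t ht
      have := hIB hy
      rw [hBt t ht z hcond.1 z' hcond.2] at this
      obtain ⟨x, hx, hyx⟩ := (Finset.mem_filter.1 this).2.2.2
      exact ⟨y, by simp, x, hx, hyx⟩
  obtain ⟨z₀, hz₀⟩ := Finset.card_pos.1 (by omega : 0 < Z.card)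
  obtain ⟨h, -, hhZ, hhinj, hhB⟩ := hc0 B hBβ Z z₀ (by omega)
  -- The term `h 0` is dropped, as nothing guarantees that it differs from the later ones.
  let H : ℕ → V := fun i => h (i + 1)
  have hHZ : ∀ i < n', H i ∈ Z := fun i hi => hhZ (i + 1) (by omega) (by omega)
  have hHP : ∀ i < n', ∀ j < n + 1, i ≠ j → i ≠ j + 1 → ∀ t ∈ J,
      ∀ x ∈ P (H j) (H (j + 1)) t, ¬ G.Adj (H i) x := by
    intro i hi j hj hij hij' t ht x hx hadj
    have h1 := hhB (i + 1) (j + 1) (by omega) (by omega) (by omega) (by omega) (by omega)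
    have hne : ∀ i < n', ∀ j < n', i ≠ j → H i ≠ H j := fun i hi j hj hij => by
      rcases lt_or_gt_of_ne hij with hlt | hlt
      · exact hhinj (i + 1) (j + 1) (by omega) (by omega) (by omega)
      · exact (hhinj (j + 1) (i + 1) (by omega) (by omega) (by omega)).symm
    apply h1
    rw [hBt t ht _ (hHZ j (by omega)) _ (hHZ (j + 1) (by omega))]
    exact Finset.mem_filter.2 ⟨hHZ i hi, hne i hi j (by omega) hij,
      hne i hi (j + 1) (by omega) hij', x, hx, hadj⟩
  -- Gathering the connecting sets of one window gives small disjoint sets, so Ramsey yields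
  -- pairwise anticomplete windows. Using a different one of them for each consecutive pair of hubs
  -- makes the connecting sets anticomplete.
  let U : ℕ → Finset V := fun t =>
    (Finset.range (n + 1)).biUnion fun j => P (H j) (H (j + 1)) t
  have hUdisj : ∀ t ∈ J, ∀ t' ∈ J, ∀ x ∈ U t, x ∈ U t' → t = t' := by
    intro t ht t' ht' x hx hx'
    obtain ⟨j, hj, hx⟩ := Finset.mem_biUnion.1 hx
    obtain ⟨j', hj', hx'⟩ := Finset.mem_biUnion.1 hx'
    rw [Finset.mem_range] at hj hj'
    exact hWdisj t (hJK t ht) t' (hJK t' ht') x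
      ((hP _ _ t (hHZ j (by omega)) (hHZ (j + 1) (by omega)) (hJK t ht)).1 hx)
      ((hP _ _ t' (hHZ j' (by omega)) (hHZ (j' + 1) (by omega)) (hJK t' ht')).1 hx')
  have hUcard : ∀ t ∈ J, (U t).card ≤ n' * n' := by
    intro t ht
    refine (Finset.card_biUnion_le_card_mul _ _ n' fun j hj => ?_).trans ?_
    · rw [Finset.mem_range] at hj
      exact (hP _ _ t (hHZ j (by omega)) (hHZ (j + 1) (by omega)) (hJK t ht)).2.1
    · rw [Finset.card_range]
      exact Nat.mul_le_mul_right _ (by omega)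
  obtain ⟨T, hTJ, hT, hTanti⟩ := (hK2 G J U hUdisj hUcard
    (((le_max_left _ _).trans (le_max_right _ _)).trans hpat)).resolve_left hG
  let τ : ℕ → ℕ := fun j => if hj : j < n' then T.orderEmbOfFin hT ⟨j, hj⟩ else 0
  have hτT : ∀ j < n', τ j ∈ T := fun j hj => by
    simp only [τ, hj, dite_true]
    exact Finset.orderEmbOfFin_mem _ _ _
  have hτinj : ∀ i < n', ∀ j < n', i ≠ j → τ i ≠ τ j := fun i hi j hj hij he => by
    simp only [τ, hi, hj, dite_true] at he
    exact hij (congrArg Fin.val ((T.orderEmbOfFin hT).injective he))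
  obtain ⟨p, hp, hpS⟩ := exists_isIndPath_of_hubs (G := G) (n := n) (H := H)
    (P := fun j => P (H j) (H (j + 1)) (τ j))
    (fun i j hij hj => hhinj (i + 1) (j + 1) (by omega) (by omega) (by omega))
    (fun i hi j hj => hind _ (hHZ i hi) _ (hHZ j hj))
    (fun j hj => (hP _ _ _ (hHZ j (by omega)) (hHZ (j + 1) (by omega))
      (hJK _ (hTJ (hτT j (by omega))))).2.2)
    (fun i hi j hj hij hij' x hx => hHP i hi j hj hij hij' _ (hTJ (hτT j (by omega))) x hx)
    (fun i hi j hj hij x hx y hy => hTanti _ (hτT i (by omega)) _ (hτT j (by omega))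
      (hτinj i (by omega) j (by omega) hij) x
      (Finset.mem_biUnion.2 ⟨i, Finset.mem_range.2 hi, hx⟩) y
      (Finset.mem_biUnion.2 ⟨j, Finset.mem_range.2 hj, hy⟩))
  refine hno' p (n + 2) le_rfl hp fun i hi => ?_
  rcases hpS i hi with ⟨j, hj, h⟩ | ⟨j, hj, h⟩
  · rw [h]
    exact (hZd _ (hHZ j hj)).1
  · have ht := hJK _ (hTJ (hτT j (by omega)))
    exact hff (hWf _ ht ((hP _ _ _ (hHZ j (by omega)) (hHZ (j + 1) (by omega)) ht).1 h))

end LongInducedPaths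

/-! ### Contracting and restoring the beginning of an induced path -/

section Contraction

variable {V : Type u} {G : SimpleGraph V}

/-- Contracting connected sets onto representatives does not increase the bags; a set of
representatives of pairwise touching sets ends up in a single bag. -/
theorem HasBags.contract {B B' K : Set V} {w : ℕ} {φ : V → V} (h : HasBags G B' w ∅)
    (hBB : B ⊆ B') (hφB : ∀ x ∈ B', φ x ∈ B) (hφ : ∀ x ∈ B, φ x = x)
    (hconn : ∀ x ∈ B', (inside G {a | a ∈ B' ∧ φ a = φ x}).Reachable x (φ x))
    (hKB : K ⊆ B) (hK : K.Nonempty)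
    (hclique : ∀ y ∈ K, ∀ z ∈ K, y ≠ z → ∃ a ∈ B', ∃ b ∈ B', φ a = y ∧ φ b = z ∧ G.Adj a b) :
    HasBags G B w K := by
  obtain ⟨n, β, h, -⟩ := h
  have hrip := rip_image (φ := φ) h.rip (by
    intro i hi j hj x hx y hy hxy
    have hx' := hconn x (h.subset i hi hx)
    have hy' := hconn y (h.subset j hj hy)
    rw [← hxy] at hy'
    have := (reachable_iff_reflTransGen _ _).1 (hx'.trans hy'.symm)
    refine Relation.ReflTransGen.mono ?_ _ _ this
    intro a b hab
    refine ⟨hab.2.1.2, hab.2.2.2, ?_⟩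
    obtain ⟨k, hk, hk'⟩ := h.exists_edge a hab.2.1.1 b hab.2.2.1 hab.1
    exact ⟨k, hk, hk'⟩)
  refine ⟨n, fun i => φ '' β i, ⟨?_, ?_, ?_, ?_, hrip⟩, ?_⟩
  · rintro i hi _ ⟨x, hx, rfl⟩
    exact hφB x (h.subset i hi hx)
  · exact fun i hi => (Set.encard_image_le _ _).trans (h.encard_le i hi)
  · intro x hx
    obtain ⟨i, hi, hxi⟩ := h.exists_mem x (hBB hx)
    exact ⟨i, hi, x, hxi, hφ x hx⟩
  · intro x hx y hy hxy
    obtain ⟨i, hi, hxi, hyi⟩ := h.exists_edge x (hBB hx) y (hBB hy) hxy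
    exact ⟨i, hi, ⟨x, hxi, hφ x hx⟩, ⟨y, hyi, hφ y hy⟩⟩
  · refine exists_subset_bag_of_pairwise n hrip K hK ?_
    intro y hy z hz
    by_cases hyz : y = z
    · subst hyz
      obtain ⟨i, hi, hyi⟩ := h.exists_mem y (hBB (hKB hy))
      exact ⟨i, hi, ⟨y, hyi, hφ y (hKB hy)⟩, ⟨y, hyi, hφ y (hKB hy)⟩⟩
    · obtain ⟨a, ha, b, hb, rfl, rfl, hab⟩ := hclique y hy z hz hyz
      obtain ⟨i, hi, hai, hbi⟩ := h.exists_edge a ha b hb hab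
      exact ⟨i, hi, ⟨a, hai, rfl⟩, ⟨b, hbi, rfl⟩⟩

/-- An initial segment of an induced path can be restored one vertex at a time. -/
theorem HasBags.restore {B : Set V} {w m : ℕ} {p : ℕ → V} {S : Finset V} (hp : IsIndPath G p m)
    (hpB : ∀ i < m, p i ∈ B) (hw : S.card + 2 ≤ w) {l : ℕ} (hl : l < m)
    (hnb : ∀ i < l, ∀ x ∈ B, G.Adj x (p i) → x ∈ S ∨ ∃ j < m, x = p j)
    (h : HasBags G (B \ p '' Set.Iio l) w (insert (p l) (S : Set V))) : HasBags G B w ∅ := by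
  induction l with
  | zero => simpa using h.mono_right (Set.empty_subset _)
  | succ l ih =>
    have hset : insert (p l) (B \ p '' Set.Iio (l + 1)) = B \ p '' Set.Iio l := by
      ext x
      constructor
      · rintro (rfl | ⟨hx, hx'⟩)
        · refine ⟨hpB l (by omega), ?_⟩
          rintro ⟨i, hi, hil⟩
          rw [Set.mem_Iio] at hi
          have := hp.injOn (by omega) (by omega) hil
          omega
        · refine ⟨hx, fun ⟨i, hi, hix⟩ => hx' ⟨i, ?_, hix⟩⟩
          rw [Set.mem_Iio] at hi ⊢
          omega
      · rintro ⟨hx, hx'⟩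
        by_cases hxl : x = p l
        · exact Or.inl hxl
        · refine Or.inr ⟨hx, fun ⟨i, hi, hix⟩ => ?_⟩
          rw [Set.mem_Iio] at hi
          rcases Nat.lt_succ_iff_lt_or_eq.1 hi with hi | rfl
          · exact hx' ⟨i, hi, hix⟩
          · exact hxl hix.symm
    -- Among the vertices present, `p l` has neighbours only in `S` and at `p (l + 1)`, so its bag
    -- has at most `S.card + 2` elements.
    have h2 := h.add_vertex (v := p l) (fun hh => hh.2 ⟨l, Set.mem_Iio.2 (by omega), rfl⟩) ?_ ?_
    · rw [hset] at h2
      refine ih (by omega) (fun i hi => hnb i (by omega)) (h2.mono_right ?_)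
      exact Set.insert_subset_insert (Set.subset_insert _ _)
    · rintro x ⟨hxB, hx⟩ hadj
      rcases hnb l (by omega) x hxB hadj.symm with hxS | ⟨j, hj, rfl⟩
      · exact Or.inr hxS
      · left
        have hjl : l + 1 ≤ j := by
          by_contra hlt
          exact hx ⟨j, Set.mem_Iio.2 (by omega), rfl⟩
        rw [(hp l j (by omega) hj).2.1 hadj]
    · calc (insert (p (l + 1)) (S : Set V)).encard + 1 ≤ ((S : Set V).encard + 1) + 1 := by
            gcongr
            exact Set.encard_insert_le _ _
        _ = ((S.card + 2 : ℕ) : ℕ∞) := by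
            rw [Set.encard_coe_eq_coe_finsetCard]
            push_cast
            rw [add_assoc]
            norm_num
        _ ≤ w := by exact_mod_cast hw

/-- If the vertices with a neighbour on the first part of an induced path are dense on a later
block, then deleting the beginning of the path does not decrease the width. -/
theorem HasBags.of_isDenseOn {B : Set V} {w m t σ : ℕ} {p : ℕ → V} {S : Finset V}
    (hp : IsIndPath G p m) (hpB : ∀ i < m, p i ∈ B) (hSB : ∀ x ∈ S, x ∈ B)
    (hSp : ∀ x ∈ S, ∀ i < m, x ≠ p i) (hw : S.card + 2 ≤ w) (hσ : 0 < σ)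
    (hm : t + (S.card + 1) * σ < m) (hS : ∀ x ∈ S, IsDenseOn G p x σ t (t + (S.card + 1) * σ))
    (hnb : ∀ i < t + (S.card + 1) * σ, ∀ x ∈ B, G.Adj x (p i) → x ∈ S ∨ ∃ j < m, x = p j)
    (h : HasBags G (B \ p '' Set.Iio t) w ∅) : HasBags G B w ∅ := by
  classical
  set d := S.card with hd
  set l := t + (d + 1) * σ with hl
  let e : Fin d ≃ S := (S.equivFin).symm
  -- Cut positions `t` to `l - 1` into `d + 1` blocks of length `σ`. The `k`-th block is contracted
  -- onto the `k`-th element of `S`, the last one onto `p l`.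
  let ψ : ℕ → V := fun i => if hi : (i - t) / σ < d then e ⟨(i - t) / σ, hi⟩ else p l
  let φ : V → V := fun x => if hx : ∃ i, t ≤ i ∧ i < l ∧ p i = x then ψ hx.choose else x
  have hφp : ∀ i, t ≤ i → i < l → φ (p i) = ψ i := by
    intro i h1 h2
    have hx : ∃ j, t ≤ j ∧ j < l ∧ p j = p i := ⟨i, h1, h2, rfl⟩
    have hc := hx.choose_spec
    have : hx.choose = i := hp.injOn (hc.2.1.trans hm) (h2.trans hm) hc.2.2
    simp only [φ, hx, dite_true, this]
  have hφx : ∀ x, (∀ i, t ≤ i → i < l → p i ≠ x) → φ x = x := by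
    intro x hx
    have : ¬ ∃ i, t ≤ i ∧ i < l ∧ p i = x := fun ⟨i, h1, h2, h3⟩ => hx i h1 h2 h3
    simp only [φ, this, dite_false]
  have hφS : ∀ x ∈ S, φ x = x := fun x hx => hφx x fun i _ h2 he =>
    hSp x hx i (h2.trans hm) he.symm
  have hφl : φ (p l) = p l := hφx _ fun i _ h2 he => by
    have := hp.injOn (h2.trans hm) hm he
    omega
  have hψ1 : ∀ (k : Fin d) i, t + k * σ ≤ i → i < t + (k + 1) * σ → ψ i = e k := by
    intro k i h1 h2
    have hk : (i - t) / σ = k := by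
      rw [Nat.div_eq_iff hσ]
      rw [add_one_mul] at h2
      omega
    simp only [ψ, hk, k.2, dite_true]
  have hψ2 : ∀ i, t + d * σ ≤ i → ψ i = p l := by
    intro i h1
    have hk : ¬ (i - t) / σ < d := by
      rw [not_lt, Nat.le_div_iff_mul_le hσ]
      omega
    simp only [ψ, hk, dite_false]
  have hkl : ∀ k : Fin d, t + (k + 1) * σ ≤ l := fun k =>
    Nat.add_le_add_left (Nat.mul_le_mul_right σ (by omega)) t
  have hl' : l = t + d * σ + σ := by rw [hl, add_one_mul, add_assoc]
  have hpadj : ∀ i, i + 1 < m → G.Adj (p i) (p (i + 1)) := fun i hi =>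
    (hp i (i + 1) (by omega) hi).2.2 rfl
  set B' := B \ p '' Set.Iio t with hB'
  have hpB' : ∀ i, t ≤ i → i < m → p i ∈ B' := by
    intro i h1 h2
    refine ⟨hpB i h2, ?_⟩
    rintro ⟨j, hj, hji⟩
    rw [Set.mem_Iio] at hj
    have := hp.injOn (by omega) h2 hji
    omega
  have hSB' : ∀ x ∈ S, x ∈ B' := fun x hx => ⟨hSB x hx, by
    rintro ⟨j, hj, hji⟩
    rw [Set.mem_Iio] at hj
    exact hSp x hx j (by omega) hji.symm⟩
  have htl : t ≤ l := Nat.le_add_right _ _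
  set B₁ := B \ p '' Set.Iio l with hB₁
  have hlB₁ : p l ∈ B₁ := ⟨hpB l hm, by
    rintro ⟨j, hj, hji⟩
    rw [Set.mem_Iio] at hj
    have := hp.injOn (by omega) hm hji
    omega⟩
  have hSB₁ : ∀ x ∈ S, x ∈ B₁ := fun x hx => ⟨hSB x hx, by
    rintro ⟨j, hj, hji⟩
    rw [Set.mem_Iio] at hj
    exact hSp x hx j (by omega) hji.symm⟩
  have hcases : ∀ i, t ≤ i → i < l → (∃ k : Fin d, t + k * σ ≤ i ∧ i < t + (k + 1) * σ) ∨
      t + d * σ ≤ i := by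
    intro i h1 h2
    by_cases hk : (i - t) / σ < d
    · left
      have h3 := Nat.div_mul_le_self (i - t) σ
      have h4 := Nat.lt_mul_div_succ (i - t) hσ
      rw [mul_comm] at h4
      exact ⟨⟨(i - t) / σ, hk⟩, by simp only; omega, by simp only; omega⟩
    · right
      rw [not_lt, Nat.le_div_iff_mul_le hσ] at hk
      omega
  -- Every element of `S` has a neighbour in every block by density, so after contraction `S` and `p
  -- l` form a clique.
  have hnear : ∀ y ∈ insert (p l) (S : Set V), ∀ v ∈ S, ∃ x ∈ B', φ x = y ∧ G.Adj v x := by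
    rintro y (rfl | hy) v hv
    · obtain ⟨j, h1, h2, hvj⟩ := hS v hv (t + d * σ) (by omega) (by omega)
      exact ⟨p j, hpB' j (by omega) (by omega), by
        rw [hφp j (by omega) (by omega), hψ2 j h1], hvj⟩
    · obtain ⟨k, hk⟩ := e.surjective ⟨y, hy⟩
      have h0 := hkl k
      have h0' : t + (k + 1) * σ = t + k * σ + σ := by rw [add_one_mul, add_assoc]
      obtain ⟨j, h1, h2, hvj⟩ := hS v hv (t + k * σ) (by omega) (by omega)
      exact ⟨p j, hpB' j (by omega) (by omega), by
        rw [hφp j (by omega) (by omega), hψ1 k j h1 (by omega), hk], hvj⟩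
  have hcon := h.contract (φ := φ) (B := B₁) (K := insert (p l) (S : Set V)) ?_ ?_ ?_ ?_ ?_ ?_ ?_
  · exact hcon.restore hp hpB hw hm hnb
  · rintro x ⟨hx, hx'⟩
    refine ⟨hx, fun ⟨i, hi, hix⟩ => hx' ⟨i, ?_, hix⟩⟩
    rw [Set.mem_Iio] at hi ⊢
    omega
  · intro x hx
    by_cases hxp : ∃ i, t ≤ i ∧ i < l ∧ p i = x
    · obtain ⟨i, h1, h2, rfl⟩ := hxp
      rw [hφp i h1 h2]
      rcases hcases i h1 h2 with ⟨k, hk1, hk2⟩ | hi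
      · rw [hψ1 k i hk1 hk2]
        exact hSB₁ _ (e k).2
      · rw [hψ2 i hi]
        exact hlB₁
    · push Not at hxp
      rw [hφx x hxp]
      refine ⟨hx.1, ?_⟩
      rintro ⟨i, hi, hix⟩
      rw [Set.mem_Iio] at hi
      by_cases hti : t ≤ i
      · exact hxp i hti hi hix
      · exact hx.2 ⟨i, Set.mem_Iio.2 (by omega), hix⟩
  · intro x hx
    exact hφx x fun i _ h2 he => hx.2 ⟨i, h2, he⟩
  · intro x hx
    by_cases hxp : ∃ i, t ≤ i ∧ i < l ∧ p i = x
    · obtain ⟨i, h1, h2, rfl⟩ := hxp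
      set C := {a | a ∈ B' ∧ φ a = φ (p i)} with hC
      rw [hφp i h1 h2] at hC ⊢
      rcases hcases i h1 h2 with ⟨k, hk1, hk2⟩ | hi
      · have h0 := hkl k
        have h0' : t + (k + 1) * σ = t + k * σ + σ := by rw [add_one_mul, add_assoc]
        rw [hψ1 k i hk1 hk2] at hC ⊢
        have hpC : ∀ j, t + k * σ ≤ j → j < t + (k + 1) * σ → p j ∈ C := fun j h3 h4 => by
          rw [hC]
          exact ⟨hpB' j (by omega) (by omega), by
            rw [hφp j (by omega) (by omega), hψ1 k j h3 h4]⟩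
        obtain ⟨j, h3, h4, hj⟩ := hS _ (e k).2 (t + k * σ) (by omega) (by omega)
        have hrch := fun i h3 h4 => reachable_inside_of_adj (G := G) (f := p)
          (fun j h5 h6 => hpadj j (by omega)) hpC (i := i) h3 h4
        have heC : (e k : V) ∈ C := by
          rw [hC]
          exact ⟨hSB' _ (e k).2, hφS _ (e k).2⟩
        exact (hrch i hk1 hk2).symm.trans ((hrch j h3 (by omega)).trans
          (Adj.reachable ⟨hj.symm, hpC j h3 (by omega), heC⟩))
      · rw [hψ2 i hi] at hC ⊢
        have hpC : ∀ j, t + d * σ ≤ j → j < l + 1 → p j ∈ C := fun j h3 h4 => by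
          rw [hC]
          refine ⟨hpB' j (by omega) (by omega), ?_⟩
          rcases Nat.lt_succ_iff_lt_or_eq.1 h4 with h4 | rfl
          · rw [hφp j (by omega) h4, hψ2 j h3]
          · exact hφl
        have hrch := fun i h3 h4 => reachable_inside_of_adj (G := G) (f := p)
          (fun j h5 h6 => hpadj j (by omega)) hpC (i := i) h3 h4
        exact (hrch i hi (by omega)).symm.trans (hrch l (by omega) (by omega))
    · push Not at hxp
      rw [hφx x hxp]
  · rintro x (rfl | hx)
    · exact hlB₁
    · exact hSB₁ x hx
  · exact ⟨p l, Set.mem_insert _ _⟩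
  · intro y hy z hz hyz
    rcases hz with rfl | hz
    · rcases hy with rfl | hy
      · exact absurd rfl hyz
      · obtain ⟨x, hx, hxz, hadj⟩ := hnear (p l) (Set.mem_insert _ _) y hy
        exact ⟨y, hSB' y hy, x, hx, hφS y hy, hxz, hadj⟩
    · obtain ⟨x, hx, hxy, hadj⟩ := hnear y hy z hz
      exact ⟨x, hx, z, hSB' z hz, hxy, hφS z hz, hadj.symm⟩

end Contraction

/-! ### Vertices attached to an induced path -/

section Attachments

variable {V : Type u} {G : SimpleGraph V}

/-- In a graph without long holes, a vertex outside an induced path is dense on the path between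
any two of its neighbours. -/
theorem isDenseOn_of_adj {p : ℕ → V} {m s a b : ℕ} {x : V} (hs : 2 ≤ s)
    (hG : ∀ k, s ≤ k → ¬ ∃ A : Set V, (G.induce A).IsCanonicalOfOrder k) (hp : IsIndPath G p m)
    (hx : ∀ i < m, x ≠ p i) (ha : G.Adj x (p a)) (hb : G.Adj x (p b)) (hbm : b < m) :
    IsDenseOn G p x s a (b + 1) := by
  classical
  intro i hai hib
  by_contra hno
  push Not at hno
  have hai' : a < i := lt_of_le_of_ne hai fun h => hno i le_rfl (by omega) (h ▸ ha)
  have hbi' : i + s ≤ b := by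
    by_contra hlt
    exact hno b (by omega) (by omega) hb
  -- Minimal `k` here locates the last neighbour at or before position `i`; `h2` locates the first
  -- one from `i` on. With the path between these two neighbours, `x` closes a long hole.
  have h1 : ∃ k, k + a < i + 1 ∧ G.Adj x (p (i - k)) := ⟨i - a, by omega, by
    rwa [show i - (i - a) = a by omega]⟩
  have h2 : ∃ k, i ≤ k ∧ G.Adj x (p k) := ⟨b, by omega, hb⟩
  have s1 := Nat.find_spec h1
  have s2 := Nat.find_spec h2
  have m1 := fun k (hk : k < Nat.find h1) => Nat.find_min h1 hk
  have m2 := fun k (hk : k < Nat.find h2) => Nat.find_min h2 hk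
  set a' := i - Nat.find h1 with ha'
  set b' := Nat.find h2 with hb'
  have hb'b : b' ≤ b := Nat.find_min' h2 ⟨by omega, hb⟩
  have hib' : i + s ≤ b' := by
    by_contra hlt
    exact hno b' s2.1 (by omega) s2.2
  have ha'i : a' < i := lt_of_le_of_ne (Nat.sub_le _ _) fun h => hno i le_rfl (by omega) (h ▸ s1.2)
  have hbetween : ∀ k, a' < k → k < b' → ¬ G.Adj x (p k) := by
    intro k hk1 hk2 hadj
    by_cases hki : i ≤ k
    · exact m2 k hk2 ⟨hki, hadj⟩
    · refine m1 (i - k) (by omega) ⟨by omega, ?_⟩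
      rwa [show i - (i - k) = k by omega]
  refine hG (b' - a' + 1 + 1) (by omega) (exists_isCanonicalOfOrder_of_hole
    (hp.shift (a := a') (m' := b' - a' + 1) (by omega)) (by omega) (x := x)
    (fun i hi => hx _ (by omega)) fun i hi => ⟨fun hadj => ?_, ?_⟩)
  · by_contra hne
    exact hbetween (a' + i) (by omega) (by omega) hadj
  · rintro (rfl | hi')
    · exact s1.2
    · show G.Adj x (p (a' + i))
      rw [show a' + i = b' by omega]
      exact s2.2

/-- Suppose every vertex attached to an induced path has a neighbour far along the path.  Then the
beginning of the path can be shortened without decreasing the width. -/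
theorem HasBags.of_attached [Finite V] {q s w M₀ : ℕ} (hq : 0 < q) (hs : 2 ≤ s)
    (hG : ∀ k, s ≤ k → ¬ ∃ A : Set V, (G.induce A).IsCanonicalOfOrder k)
    (hK : ¬ IsContained (completeBipartiteGraph (Fin q) (Fin q)) G)
    (hw : q * s + 1 ≤ w) (hM₀ : M₀ = (q * s + 2) * ((q * s + 1) * s))
    {B : Set V} (ih : ∀ B' ⊂ B, HasBags G B' w ∅) {p : ℕ → V} {m : ℕ} (hp : IsIndPath G p m)
    (hpB : ∀ i < m, p i ∈ B)
    (hm : M₀ + q * (s ^ (q * s) * 2 ^ (q * s)) * s + 1 ≤ m)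
    (hlast : ∀ x ∈ B, (∀ i < m, x ≠ p i) → (∃ i < m, G.Adj x (p i)) →
      ∃ j < m, M₀ + q * (s ^ (q * s) * 2 ^ (q * s)) * s ≤ j ∧ G.Adj x (p j)) :
    HasBags G B w ∅ := by
  classical
  set Q := q * s with hQ
  set K := q * (s ^ Q * 2 ^ Q) with hKdef
  set g := (Q + 1) * s with hg
  have hdense : ∀ x ∈ B, (∀ i < m, x ≠ p i) → ∀ i < m, G.Adj x (p i) →
      IsDenseOn G p x s i (M₀ + K * s + 1) := by
    intro x hx hxp i hi hadj
    obtain ⟨j, hj, hMj, hadj'⟩ := hlast x hx hxp ⟨i, hi, hadj⟩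
    exact (isDenseOn_of_adj hs hG hp hxp hadj hadj' hj).mono le_rfl le_rfl (by omega)
  let F : Set V := {x | x ∈ B ∧ (∀ i < m, x ≠ p i) ∧ ∃ i < M₀, G.Adj x (p i)}
  have hFfin : F.Finite := Set.toFinite F
  set T := hFfin.toFinset with hT
  have hTF : ∀ x, x ∈ T ↔ x ∈ F := fun x => hFfin.mem_toFinset
  -- The vertices in `T` have neighbours in each of the `K` windows of length `s` after position
  -- `M₀`; `Q` of them would give `K_{q,q}`.
  have hTQ : T.card < Q := by
    by_contra hlt
    obtain ⟨I, hIT, hI⟩ := Finset.exists_subset_card_eq (s := T) (n := Q) (by omega)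
    refine hK (isContained_completeBipartiteGraph_of_families hq (n := s) (by omega) (I := I)
      (J := Finset.range K) (A := fun y => {y})
      (B := fun t => (Finset.Ico (M₀ + t * s) (M₀ + (t + 1) * s)).image p) (by simp) ?_ ?_ ?_
      hI.ge ?_ ?_)
    · have hb : ∀ t < K, M₀ + (t + 1) * s ≤ M₀ + K * s := fun t ht =>
        Nat.add_le_add_left (Nat.mul_le_mul_right s ht) _
      have key : ∀ t t' i j, t < K → t' < K → i < M₀ + (t + 1) * s → M₀ + t' * s ≤ j →
          j < M₀ + (t' + 1) * s → p i = p j → ¬ t < t' := by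
        intro t t' i j ht ht' h1 h2 h3 hij htt
        have h4 := hb t ht
        have h5 := hb t' ht'
        have := hp.injOn (by omega) (by omega) hij
        have h6 : (t + 1) * s ≤ t' * s := Nat.mul_le_mul_right s htt
        omega
      intro t ht t' ht' x hx hx'
      obtain ⟨i, hi, rfl⟩ := Finset.mem_image.1 hx
      obtain ⟨j, hj, hji⟩ := Finset.mem_image.1 hx'
      rw [Finset.mem_Ico] at hi hj
      rw [Finset.mem_range] at ht ht'
      have := key t t' i j ht ht' hi.2 hj.1 hj.2 hji.symm
      have := key t' t j i ht' ht hj.2 hi.1 hi.2 hji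
      omega
    · intro y _
      simp only [Finset.card_singleton]
      omega
    · intro t _
      refine Finset.card_image_le.trans ?_
      rw [Nat.card_Ico, add_one_mul]
      omega
    · rw [hI, Finset.card_range]
    · intro y hy t ht
      rw [Finset.mem_range] at ht
      obtain ⟨hyB, hyp, i, hi, hadj⟩ := (hTF y).1 (hIT hy)
      have h1 : M₀ + (t + 1) * s ≤ M₀ + K * s := Nat.add_le_add_left (Nat.mul_le_mul_right s ht) _
      rw [add_one_mul, ← add_assoc] at h1
      obtain ⟨j, hj1, hj2, hadj'⟩ := hdense y hyB hyp i (by omega) hadj (M₀ + t * s) (by omega)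
        (by omega)
      exact ⟨y, by simp, p j, Finset.mem_image.2 ⟨j, Finset.mem_Ico.2 ⟨hj1, by
        rw [add_one_mul, ← add_assoc]; exact hj2⟩, rfl⟩, hadj'⟩
  have hfirst : ∀ x, ∃ i, x ∈ T → i < M₀ ∧ G.Adj x (p i) ∧ ∀ j < i, ¬ G.Adj x (p j) := by
    intro x
    by_cases hx : x ∈ T
    · obtain ⟨-, -, i, hi, hadj⟩ := (hTF x).1 hx
      have hex : ∃ i, G.Adj x (p i) := ⟨i, hadj⟩
      exact ⟨Nat.find hex, fun _ => ⟨(Nat.find_min' hex hadj).trans_lt hi, Nat.find_spec hex,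
        fun j hj => Nat.find_min hex hj⟩⟩
    · exact ⟨0, fun h => absurd h hx⟩
  choose first hfirst using hfirst
  -- One of `Q + 1` blocks of length `g` contains no first neighbour of a vertex in `T`. Starting at
  -- `c = 1` makes the part of the path before the block nonempty, so the induction is on a proper
  -- subset.
  obtain ⟨c, hc, hcT⟩ := Finset.exists_mem_notMem_of_card_lt_card
    (s := T.image fun x => first x / g) (t := Finset.Icc 1 (Q + 1)) (by
      rw [Nat.card_Icc]
      exact Finset.card_image_le.trans_lt (by omega))
  rw [Finset.mem_Icc] at hc
  have hg0 : 0 < g := by positivity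
  have hgc : g ≤ c * g := Nat.le_mul_of_pos_left g hc.1
  have hcM : c * g + g ≤ M₀ := by
    rw [hM₀, ← add_one_mul]
    exact Nat.mul_le_mul_right g (by omega)
  -- Vertices with first neighbour before the block are dense on it; all other attached vertices
  -- have no neighbour up to its end.
  set S := T.filter fun x => first x < c * g with hS
  have hST : ∀ x ∈ S, x ∈ T := fun x hx => (Finset.mem_filter.1 hx).1
  have hSQ : S.card < Q := (Finset.card_filter_le _ _).trans_lt hTQ
  have hSg : (S.card + 1) * s ≤ g := Nat.mul_le_mul_right s (by omega)
  refine HasBags.of_isDenseOn (S := S) (t := c * g) (σ := s) hp hpB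
    (fun x hx => ((hTF x).1 (hST x hx)).1) (fun x hx => ((hTF x).1 (hST x hx)).2.1) (by omega)
    (by omega) (by omega) ?_ ?_ (ih _ ?_)
  · intro x hx
    obtain ⟨h1, h2, h3⟩ := (hTF x).1 (hST x hx)
    obtain ⟨h4, h5, -⟩ := hfirst x (hST x hx)
    have h6 := (Finset.mem_filter.1 hx).2
    exact (hdense x h1 h2 (first x) (by omega) h5).mono le_rfl h6.le (by omega)
  · intro i hi x hx hadj
    by_cases hxp : ∃ j < m, x = p j
    · exact Or.inr hxp
    left
    push Not at hxp
    have hxT : x ∈ T := (hTF x).2 ⟨hx, hxp, i, by omega, hadj⟩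
    obtain ⟨h4, h5, h6⟩ := hfirst x hxT
    refine Finset.mem_filter.2 ⟨hxT, ?_⟩
    have hfi : first x ≤ i := by
      by_contra hlt
      exact h6 i (by omega) hadj
    by_contra hlt
    refine hcT (Finset.mem_image.2 ⟨x, hxT, ?_⟩)
    rw [Nat.div_eq_iff hg0]
    omega
  · refine ⟨Set.sdiff_subset, fun hsub => ?_⟩
    exact (hsub (hpB 0 (by omega))).2 ⟨0, Set.mem_Iio.2 (by omega), rfl⟩

/-- If two vertices attach to a longest induced path near opposite ends only, then there is a long
hole or a long `H`-graph. -/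
theorem exists_isCanonicalOfOrder_of_far {B : Set V} {p : ℕ → V} {m a b s : ℕ} {x y : V}
    (hs : 2 ≤ s) (hp : IsIndPath G p m) (hpB : ∀ i < m, p i ∈ B)
    (hmax : ∀ p' m', IsIndPath G p' m' → (∀ i < m', p' i ∈ B) → m' ≤ m) (hxB : x ∈ B)
    (hyB : y ∈ B) (hx : ∀ i < m, x ≠ p i) (hy : ∀ i < m, y ≠ p i)
    (hxa : G.Adj x (p a)) (hxl : ∀ i < m, a < i → ¬ G.Adj x (p i))
    (hyb : G.Adj y (p b)) (hyl : ∀ i < b, ¬ G.Adj y (p i)) (hbm : b < m) (hab : a + s ≤ b) :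
    ∃ k, s ≤ k ∧ ∃ A : Set V, (G.induce A).IsCanonicalOfOrder k := by
  -- If `a = 0`, then `x` would extend the longest path; `b` is not the last index for the same
  -- reason. So `p (a - 1)` and `p (b + 1)` are available as wings.
  have ha : 0 < a := by
    by_contra h0
    obtain rfl : a = 0 := by omega
    have := hmax _ _ (hp.cons (x := x) hx fun i hi => ⟨fun h => by_contra fun h0 =>
      hxl i hi (by omega) h, fun h => h ▸ hxa⟩) (by
        intro i hi
        cases i with
        | zero => exact hxB
        | succ i => exact hpB i (by omega))
    omega
  have hb : b + 1 < m := by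
    by_contra h0
    have := hmax _ _ (hp.reverse.cons (x := y) (fun i hi => hy _ (by omega)) fun i hi =>
      ⟨fun h => by_contra fun h0 => hyl (m - 1 - i) (by omega) h, fun h => by
        subst h
        simpa [show m - 1 = b by omega] using hyb⟩) (by
        intro i hi
        cases i with
        | zero => exact hyB
        | succ i => exact hpB (m - 1 - i) (by omega))
    omega
  have hxy : x ≠ y := fun h => hyl a (by omega) (h ▸ hxa)
  -- If adjacent, `x` and `y` close a hole with `p a, …, p b`; otherwise that segment is the body of
  -- an `H`-graph.
  by_cases hadj : G.Adj x y
  · have h1 := (hp.shift (a := a) (m' := b - a + 1) (by omega)).reverse.cons (x := y)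
      (fun i hi => hy _ (by omega)) (fun i hi => ⟨fun h => by_contra fun h0 =>
        hyl (a + (b - a + 1 - 1 - i)) (by omega) h, fun h => by
          subst h
          simpa [show a + (b - a) = b by omega] using hyb⟩)
    refine ⟨_, ?_, exists_isCanonicalOfOrder_of_hole (x := x) h1 (by omega) ?_ ?_⟩
    · omega
    · intro i hi
      cases i with
      | zero => exact hxy
      | succ i => exact hx _ (by omega)
    · intro i hi
      cases i with
      | zero => simpa using hadj
      | succ i =>
        constructor
        · intro h
          by_contra h0
          exact hxl (a + (b - a + 1 - 1 - i)) (by omega) (by omega) h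
        · intro h
          show G.Adj x (p (a + (b - a + 1 - 1 - i)))
          rw [show a + (b - a + 1 - 1 - i) = a by omega]
          exact hxa
  · refine ⟨b - a + 1, by omega, exists_isCanonicalOfOrder_of_wings (x := x) (y := y)
      (hp.shift (a := a - 1) (m' := b - a + 1 + 2) (by omega)) (by omega)
      (fun i hi => hx _ (by omega)) (fun i hi => hy _ (by omega)) hxy hadj ?_ ?_ ?_ ?_⟩
    · show G.Adj x (p (a - 1 + 1))
      rwa [show a - 1 + 1 = a by omega]
    · exact fun i h1 h2 => hxl _ (by omega) (by omega)
    · show G.Adj y (p (a - 1 + (b - a + 1)))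
      rwa [show a - 1 + (b - a + 1) = b by omega]
    · exact fun i h1 => hyl _ (by omega)

end Attachments

/-! ### The induction bounding the bags, and the theorem -/

/-- A graph without long holes, long `H`-graphs and `K_{q,q}` has bags of bounded size. -/
theorem exists_forall_hasBags {s q : ℕ} (hs : 2 ≤ s) (hq : 0 < q) : ∃ X : ℕ, 0 < X ∧
    ∀ {V : Type u} [Finite V] (G : SimpleGraph V),
    (∀ k, s ≤ k → ¬ ∃ A : Set V, (G.induce A).IsCanonicalOfOrder k) →
    ¬ IsContained (completeBipartiteGraph (Fin q) (Fin q)) G →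
    ∀ B : Set V, HasBags G B X ∅ := by
  classical
  set M₀ := (q * s + 2) * ((q * s + 1) * s) with hM₀
  set M := M₀ + q * (s ^ (q * s) * 2 ^ (q * s)) * s with hM
  -- The length leaves a gap of more than `s` between the two end segments of `M` vertices.
  obtain ⟨N, hN⟩ := exists_isIndPath_of_path.{u} (2 * M + s + 1) hq
  refine ⟨max N (q * s + 1), by omega, fun {V} _ G hG hK B => ?_⟩
  induction B using WellFoundedLT.induction with
  | _ B ih =>
  by_cases hlong : ∀ l : List V, l.IsChain G.Adj → l.Nodup → (∀ x ∈ l, x ∈ B) → l.length ≤ N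
  · exact (hasBags_of_forall_isChain_length_le (Set.toFinite B) hlong).mono_width (le_max_left _ _)
  push Not at hlong
  obtain ⟨l, hl, hnd, hlB, hlN⟩ := hlong
  have hne : l ≠ [] := by rintro rfl; simp at hlN
  let f : ℕ → V := fun i => l.getD i (l.head hne)
  have hf : ∀ i (hi : i < l.length), f i = l[i] := fun i hi => List.getD_eq_getElem _ _ hi
  obtain ⟨p₀, hp₀, hp₀f⟩ := hN G f 0 N (fun i _ hi => by
      rw [hf i (by omega), hf (i + 1) (by omega)]
      exact List.isChain_iff_getElem.1 hl i (by omega))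
    (fun i hi j hj hij => by
      rw [Set.mem_Ico] at hi hj
      rw [hf i (by omega), hf j (by omega)] at hij
      exact (hnd.getElem_inj_iff).1 hij) (by omega) hK
  have hp₀B : ∀ i < 2 * M + s + 1, p₀ i ∈ B := by
    intro i hi
    obtain ⟨j, hj, hji⟩ := hp₀f i hi
    rw [← hji, hf j (by have := hj.2; omega)]
    exact hlB _ (List.getElem_mem _)
  let good : ℕ → Prop := fun m => ∃ p, IsIndPath G p m ∧ ∀ i < m, p i ∈ B
  have hgood : good (2 * M + s + 1) := ⟨p₀, hp₀, hp₀B⟩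
  obtain ⟨p, hp, hpB⟩ := Nat.findGreatest_spec (P := good) hp₀.le_card hgood
  have hmm := Nat.le_findGreatest (P := good) hp₀.le_card hgood
  have hmax : ∀ p' m', IsIndPath G p' m' → (∀ i < m', p' i ∈ B) →
      m' ≤ Nat.findGreatest good (Nat.card V) := fun p' m' h1 h2 =>
    Nat.le_findGreatest h1.le_card ⟨p', h1, h2⟩
  set m := Nat.findGreatest good (Nat.card V) with hm
  by_cases hlast : ∀ x ∈ B, (∀ i < m, x ≠ p i) → (∃ i < m, G.Adj x (p i)) →
      ∃ j < m, M ≤ j ∧ G.Adj x (p j)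
  · exact HasBags.of_attached hq hs hG hK (le_max_right _ _) hM₀ (fun B' hB' => ih B' hB') hp hpB
      (by omega) hlast
  push Not at hlast
  obtain ⟨x, hxB, hxp, ⟨a₀, ha₀m, ha₀⟩, hxM⟩ := hlast
  -- Since `x` attaches only among the first `M` vertices, no `y` can attach only among the last
  -- `M`; hence the reversed path satisfies the hypothesis.
  refine HasBags.of_attached hq hs hG hK (le_max_right _ _) hM₀ (fun B' hB' => ih B' hB')
    hp.reverse (fun i hi => hpB _ (by omega)) (by omega) ?_
  rintro y hyB hyp ⟨b₀, hb₀m, hb₀⟩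
  have hyp' : ∀ i < m, y ≠ p i := fun i hi => by
    have := hyp (m - 1 - i) (by omega)
    rwa [show m - 1 - (m - 1 - i) = i by omega] at this
  by_contra hno
  push Not at hno
  have hyM : ∀ i, i + M < m → ¬ G.Adj y (p i) := fun i hi h =>
    hno (m - 1 - i) (by omega) (by omega) (by rwa [show m - 1 - (m - 1 - i) = i by omega])
  -- Counting back from `m`, the least `k` gives the last neighbour of `x`.
  have hexa : ∃ k, 0 < k ∧ k ≤ m ∧ G.Adj x (p (m - k)) := ⟨m - a₀, by omega, by omega, by
    rwa [show m - (m - a₀) = a₀ by omega]⟩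
  have hexb : ∃ k, G.Adj y (p k) := ⟨_, hb₀⟩
  have sa := Nat.find_spec hexa
  have sb := Nat.find_spec hexb
  have ma := fun k (hk : k < Nat.find hexa) => Nat.find_min hexa hk
  have mb := fun k (hk : k < Nat.find hexb) => Nat.find_min hexb hk
  have hb₁ := Nat.find_min' hexb hb₀
  have ha₁ : m - Nat.find hexa < M := by
    by_contra hlt
    exact hxM _ (by omega) (by omega) sa.2.2
  have hb₂ : m ≤ Nat.find hexb + M := by
    by_contra hlt
    exact hyM _ (by omega) sb
  obtain ⟨k, hk, hA⟩ := exists_isCanonicalOfOrder_of_far hs hp hpB hmax hxB hyB hxp hyp' sa.2.2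
    (fun i hi hai hadj => ma (m - i) (by omega) ⟨by omega, by omega, by
      rwa [show m - (m - i) = i by omega]⟩) sb mb (by omega) (by omega)
  exact hG k hk hA

end SimpleGraph

theorem mainTheorem2 (s q : ℕ) :
    ∃ X : ℕ, ∀ (V : Type u) [Finite V] (G : SimpleGraph V), (X : ℕ∞) ≤ G.treewidth →
      (∃ m : ℕ, s ≤ m ∧ ∃ A : Set V, (G.induce A).IsCanonicalOfOrder m) ∨
      SimpleGraph.IsContained (completeBipartiteGraph (Fin q) (Fin q)) G := by
  rcases Nat.eq_zero_or_pos q with rfl | hq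
  · exact ⟨0, fun V _ G _ => Or.inr
      (SimpleGraph.isContained_completeBipartiteGraph_of_finset (S := ∅) (T := ∅) (by simp)
        (by simp) (by simp))⟩
  -- Raising `s` by two meets the requirement `2 ≤ s` and only strengthens the conclusion.
  obtain ⟨X, hX, h⟩ := SimpleGraph.exists_forall_hasBags.{u} (s := s + 2) (by omega) hq
  refine ⟨X, fun V _ G hXG => ?_⟩
  by_contra hno
  rw [not_or] at hno
  have := SimpleGraph.treewidth_lt_of_hasBags hX
    (h G (fun k hk hA => hno.1 ⟨k, by omega, hA⟩) hno.2 Set.univ)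
  exact absurd hXG (not_le.2 this)
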